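/- Let $q\in(0,1)$, $e\in[0,1]$, $a\in(0,1)$. Consider the memoryless channel with binary input $X\in\{0,1\}$ and i.i.d. state $S\sim\mathrm{Bernoulli}(q)$, with outputs $Y=SX\in\{0,1\}$ at a communication receiver and $Z=aSX+\big((X+N)\bmod 2\big)\in\{0,1,a,a+1\}$ at a sensing receiver, where $N\sim\mathrm{Bernoulli}(e)$ and $S,N$ are independent of each other and of $X$. A code of length $n$ and rate $R\ge 0$ with full-decoding-based estimation consists of an encoder $x^n(w)$ for a message $w$ uniform on $[1:2^{nR}]$ (a set of $\lceil 2^{nR}\rceil$ elements), a decoder of $w$ from $(Y^n,S^n)$, a decoder of $w$ from $Z^n$, and an estimator $\hat S^n=h_n(Z^n)\in\{0,1\}^n$. A pair $(R,D)$ is achievable if there is a sequence of such codes, one for each $n$, for which the probability that at least one decoder errs tends to $0$ and $\varlimsup_n \frac1n\sum_{i=1}^n \Pr\{\hat S_i\ne S_i\}\le D$ (Hamming distortion). The capacity-distortion region is the closure in $\mathbb{R}^2$ of the set of achievable pairs, and $C(D)$ is the supremum of all $R$ such that $(R,D)$ lies in that region. For $p\in[0,1]$ let $P_X(0)=p$,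 let $X$ be independent of $(S,N)$, write $\bar t=1-t$, $H_2(t)=-t\log_2t-\bar t\log_2\bar t$ (with $0\log_2 0=0$), and put $f(p)=\min\{qH_2(p),I(X;Z)\}$, with $I(X;Z)$ in bits. Then: 1. For all $p\in[0,1]$, $$I(X;Z)=-\sum_{i=1}^4p_i\log_2p_i-pH_2(e)+\bar p\sum_{i=1}^4p_{i1}\log_2p_{i1},$$ where $p_1=pe+\bar q\bar p\bar e$, $p_2=p\bar e+\bar q\bar pe$, $p_3=\bar pqe$, $p_4=\bar pq\bar e$, $p_{11}=\bar q\bar e$, $p_{21}=\bar qe$, $p_{31}=qe$, $p_{41}=q\bar e$. 2. The function $f$ has exactly one maximizer $p_{\max}$ on $[0,1]$. The capacity-distortion region equals $$\{(R,D): 0\le R\le f(p),\ p\min\{q,1-q\}\le D\text{ for some }p\in[0,p_{\max}]\}.$$ 3. For each $p\in[0,p_{\max}]$, $f(p)$ is the largest $R$ such that $(R,\,p\min\{q,1-q\})$ lies in the region. The curve $\{(C(D),D):0\le D\le p_{\max}\min\{q,1-q\}\}$ is therefore $$\big\{\big(f(p),\,p\min\{q,1-q\}\big):p\in[0,p_{\max}]\big\},$$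 and $C(D)=f(p_{\max})$ for all $D\ge p_{\max}\min\{q,1-q\}$. -/

import Mathlib

open Filter Topology

noncomputable section

/-- A two-receiver state-dependent memoryless broadcast channel with finite input alphabet `X`,
state alphabet `S` and output alphabets `Y` (communication receiver) and `Z` (sensing receiver):
the state pmf `P_S`, the transition pmf `P_{YZ|XS}` and a nonnegative distortion measure on
`S × S`. -/
structure SDMBC (X S Y Z : Type) [Fintype S] [Fintype Y] [Fintype Z] where
  /-- the state pmf -/
  PS : S → ℝ
  PS_nonneg : ∀ s, 0 ≤ PS s
  PS_sum : ∑ s, PS s = 1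
  /-- `trans x s y z = P_{YZ|XS}(y, z | x, s)` -/
  trans : X → S → Y → Z → ℝ
  trans_nonneg : ∀ x s y z, 0 ≤ trans x s y z
  trans_sum : ∀ x s, ∑ y, ∑ z, trans x s y z = 1
  /-- the distortion measure -/
  dist : S → S → ℝ
  dist_nonneg : ∀ s s', 0 ≤ dist s s'

/-- A code of block length `n` with `M0` common and `M1` private messages: an encoder,
a decoder at the communication receiver (which sees `(y^n, s^n)` and recovers both messages),
a decoder at the sensing receiver (which sees `z^n` and recovers the common message), and a state
estimator at the sensing receiver. -/
structure DMSCode (X S Y Z : Type) (M0 M1 n : ℕ) where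
  enc : Fin M0 → Fin M1 → (Fin n → X)
  dec1 : (Fin n → Y) → (Fin n → S) → Fin M0 × Fin M1
  dec2 : (Fin n → Z) → Fin M0
  est : (Fin n → Z) → (Fin n → S)

/-- The number of elements of the message set `[1 : 2^{nR}]`. -/
def msgCount (R : ℝ) (n : ℕ) : ℕ := ⌈(2 : ℝ) ^ ((n : ℝ) * R)⌉₊

namespace SDMBC

variable {X S Y Z : Type} [Fintype S] [Fintype Y] [Fintype Z]

/-- The probability of `(s^n, y^n, z^n)` when the word `x^n` is transmitted:
the states are i.i.d. and the channel is memoryless. -/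
def blockProb (ch : SDMBC X S Y Z) {n : ℕ} (x : Fin n → X) (s : Fin n → S) (y : Fin n → Y)
    (z : Fin n → Z) : ℝ :=
  ∏ i, ch.PS (s i) * ch.trans (x i) (s i) (y i) (z i)

/-- The average probability, over uniformly distributed messages, that at least one of the two
decoders errs. -/
def errorProb (ch : SDMBC X S Y Z) {M0 M1 n : ℕ} (c : DMSCode X S Y Z M0 M1 n) : ℝ :=
  (1 / ((M0 : ℝ) * (M1 : ℝ))) * ∑ w0 : Fin M0, ∑ w1 : Fin M1,
    ∑ s : Fin n → S, ∑ y : Fin n → Y, ∑ z : Fin n → Z,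
      ch.blockProb (c.enc w0 w1) s y z *
        (if c.dec1 y s ≠ (w0, w1) ∨ c.dec2 z ≠ w0 then 1 else 0)

/-- The expected average per-block distortion of the state estimate. -/
def distortion (ch : SDMBC X S Y Z) {M0 M1 n : ℕ} (c : DMSCode X S Y Z M0 M1 n) : ℝ :=
  (1 / ((M0 : ℝ) * (M1 : ℝ))) * ∑ w0 : Fin M0, ∑ w1 : Fin M1,
    ∑ s : Fin n → S, ∑ y : Fin n → Y, ∑ z : Fin n → Z,
      ch.blockProb (c.enc w0 w1) s y z *
        ((1 / (n : ℝ)) * ∑ i, ch.dist (s i) (c.est z i))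

/-- Achievability of a rate-distortion tuple `(R0, R1, D)`. -/
def Achievable (ch : SDMBC X S Y Z) (R0 R1 D : ℝ) : Prop :=
  0 ≤ R0 ∧ 0 ≤ R1 ∧
    ∃ c : ∀ n : ℕ, DMSCode X S Y Z (msgCount R0 n) (msgCount R1 n) n,
      Tendsto (fun n => ch.errorProb (c n)) atTop (𝓝 0) ∧
        limsup (fun n => ch.distortion (c n)) atTop ≤ D

/-- The capacity-distortion region with full-decoding-based estimation: there is no private
message (`R1 = 0`), so both receivers decode the whole message; the region is the closure of the
set of achievable pairs `(R, D)`. -/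
def fullDecodingRegion (ch : SDMBC X S Y Z) : Set (ℝ × ℝ) :=
  closure {t | ch.Achievable t.1 0 t.2}

/-- The capacity-distortion function with full-decoding-based estimation. -/
def fullDecodingCapacity (ch : SDMBC X S Y Z) (D : ℝ) : ℝ :=
  sSup {R | (R, D) ∈ ch.fullDecodingRegion}

/-- The joint pmf of `(X, Z)` when `(X, S, Y, Z)` has law `P_X P_S P_{YZ|XS}`. -/
def jointXZ (ch : SDMBC X S Y Z) (PX : X → ℝ) (x : X) (z : Z) : ℝ :=
  ∑ s, ∑ y, PX x * ch.PS s * ch.trans x s y z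

end SDMBC

/-- Mutual information (in bits) of a joint pmf on a product of two finite sets. -/
def mutualInfoBits {A B : Type} [Fintype A] [Fintype B] (P : A → B → ℝ) : ℝ :=
  ∑ a, ∑ b, P a b * Real.logb 2 (P a b / ((∑ b', P a b') * (∑ a', P a' b)))

/-- The binary entropy function in bits. -/
def H2 (p : ℝ) : ℝ := -p * Real.logb 2 p - (1 - p) * Real.logb 2 (1 - p)

/-- The Bernoulli(`r`) pmf on `{0, 1}`: `1` has probability `r`. -/
def bern (r : ℝ) (i : Fin 2) : ℝ := if i = 1 then r else 1 - r

theorem bern_nonneg {r : ℝ} (h0 : 0 ≤ r) (h1 : r ≤ 1) (i : Fin 2) : 0 ≤ bern r i := by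
  unfold bern
  split_ifs <;> linarith

theorem bern_sum (r : ℝ) : ∑ i, bern r i = 1 := by
  simp [bern, Fin.sum_univ_two]

/-- The output alphabet `{0, 1, a, a + 1}` of the sensing receiver. -/
abbrev SenseAlphabet (a : ℝ) : Type := ↥({0, 1, a, a + 1} : Finset ℝ)

/-- The sensing output `a s x + ((x + n) mod 2)`. -/
def senseValue (a : ℝ) (x s n : Fin 2) : ℝ :=
  a * (s.val : ℝ) * (x.val : ℝ) + (((x.val + n.val) % 2 : ℕ) : ℝ)

theorem senseValue_mem (a : ℝ) (x s n : Fin 2) :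
    senseValue a x s n ∈ ({0, 1, a, a + 1} : Finset ℝ) := by
  fin_cases x <;> fin_cases s <;> fin_cases n <;> simp [senseValue]

/-- `P_{YZ|XS}(y, z | x, s)` for `Y = S X` and `Z = a S X + ((X + N) mod 2)`, where `N` is
Bernoulli(`e`) and independent of `(X, S)`. -/
def exampleTrans (e a : ℝ) (x s y : Fin 2) (z : SenseAlphabet a) : ℝ :=
  ∑ n : Fin 2, bern e n * (if y = s * x ∧ (z : ℝ) = senseValue a x s n then 1 else 0)

theorem exampleTrans_sum (e a : ℝ) (x s : Fin 2) :
    ∑ y, ∑ z, exampleTrans e a x s y z = 1 := by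
  have key : ∀ n : Fin 2, ∑ y : Fin 2, ∑ z : SenseAlphabet a,
      bern e n * (if y = s * x ∧ (z : ℝ) = senseValue a x s n then (1 : ℝ) else 0)
        = bern e n := by
    intro n
    rw [Finset.sum_eq_single (s * x)]
    · rw [Finset.sum_eq_single ⟨senseValue a x s n, senseValue_mem a x s n⟩]
      · simp
      · intro z _ hz
        have : (z : ℝ) ≠ senseValue a x s n := fun h => hz (Subtype.ext h)
        simp [this]
      · exact fun h => absurd (Finset.mem_univ _) h
    · intro y _ hy
      simp [hy]
    · simp
  unfold exampleTrans
  calc ∑ y : Fin 2, ∑ z : SenseAlphabet a, ∑ n : Fin 2,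
        bern e n * (if y = s * x ∧ (z : ℝ) = senseValue a x s n then (1 : ℝ) else 0)
      = ∑ y : Fin 2, ∑ n : Fin 2, ∑ z : SenseAlphabet a,
        bern e n * (if y = s * x ∧ (z : ℝ) = senseValue a x s n then (1 : ℝ) else 0) :=
        Finset.sum_congr rfl fun y _ => Finset.sum_comm
    _ = ∑ n : Fin 2, ∑ y : Fin 2, ∑ z : SenseAlphabet a,
        bern e n * (if y = s * x ∧ (z : ℝ) = senseValue a x s n then (1 : ℝ) else 0) :=
        Finset.sum_comm
    _ = 1 := by rw [Finset.sum_congr rfl fun n _ => key n, bern_sum]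

/-- The binary example: `S` is Bernoulli(`q`), `Y = S X`, `Z = a S X + ((X + N) mod 2)` with `N`
Bernoulli(`e`), and Hamming distortion. -/
def exampleChannel (q e a : ℝ) (hq : q ∈ Set.Ioo (0 : ℝ) 1) (he : e ∈ Set.Icc (0 : ℝ) 1) :
    SDMBC (Fin 2) (Fin 2) (Fin 2) (SenseAlphabet a) where
  PS := bern q
  PS_nonneg := bern_nonneg hq.1.le hq.2.le
  PS_sum := bern_sum q
  trans := exampleTrans e a
  trans_nonneg := by
    intro x s y z
    refine Finset.sum_nonneg fun n _ => mul_nonneg (bern_nonneg he.1 he.2 n) ?_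
    split_ifs <;> norm_num
  trans_sum := exampleTrans_sum e a
  dist := fun s s' => if s = s' then 0 else 1
  dist_nonneg := by
    intro s s'
    split_ifs <;> norm_num

/-- `I(X; Z)` in the binary example when `P_X(0) = p`. -/
def exampleIXZ (q e a : ℝ) (hq : q ∈ Set.Ioo (0 : ℝ) 1) (he : e ∈ Set.Icc (0 : ℝ) 1)
    (p : ℝ) : ℝ :=
  mutualInfoBits ((exampleChannel q e a hq he).jointXZ (bern (1 - p)))

/-- `min {q H_2(p), I(X; Z)}` in the binary example when `P_X(0) = p`. -/
def exampleRate (q e a : ℝ) (hq : q ∈ Set.Ioo (0 : ℝ) 1) (he : e ∈ Set.Icc (0 : ℝ) 1)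
    (p : ℝ) : ℝ :=
  min (q * H2 p) (exampleIXZ q e a hq he p)

end

/-! The converse and the random-coding bound are both governed by one parameter p, the frequency of
the input letter 0, and they meet after taking closures.

Converse: take p to be the fraction of zeros among all letters of the codebook. Comparing the
channel with the product output law induced by this fraction bounds log M times the probability of
correct decoding by n I + 1, for each receiver (`log_card_mul_correct_le_infoNats`). The
communication receiver sees an erasure channel, with information q H(p); the sensing receiver has
I(X;Z). The same p bounds the distortion: when 0 is sent the outputs carry no information on the
state, so every zero costs at least min(q, 1 - q) (`example_dist_lower`,
`sum_codeType_mul_le_distortion`). Compactness of [0, 1] provides a limiting p.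

Achievability: an i.i.d. codebook with likelihood-threshold decoding has exponentially small error
at every rate below both informations (`achievable_of_lt_infoNats`). The sensing receiver decodes
the codeword and then estimates letter by letter: under input 1 the output reveals the state, and
under input 0 the more likely state is guessed.

Geometry: f is a minimum of two strictly concave functions and vanishes at 0 and 1. Hence it has one
maximizer and is nondecreasing before it, and values of p beyond it lose both rate and distortion.
`closure_eq_regionBelow` turns the two bounds into the exact region; the claims on the curve follow
from monotonicity. -/

/-! ### Expectations under product laws. -/

section ProductSums

variable {ι α : Type} [Fintype ι] [DecidableEq ι] [Fintype α]

theorem sum_prod_mul_apply (p : ι → α → ℝ) (hp : ∀ i, ∑ a, p i a = 1) (i : ι) (g : α → ℝ) :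
    ∑ x : ι → α, (∏ j, p j (x j)) * g (x i) = ∑ a, p i a * g a := by
  have h : ∀ x : ι → α, (∏ j, p j (x j)) * g (x i)
      = ∏ j, p j (x j) * (if j = i then g (x j) else 1) := by
    intro x
    rw [Finset.prod_mul_distrib, Finset.prod_ite_eq' Finset.univ i (fun j => g (x j))]
    simp
  simp_rw [h]
  rw [← Fintype.prod_sum fun j a => p j a * (if j = i then g a else 1),
    Finset.prod_eq_single i]
  · simp
  · intro j _ hj
    simp [hj, hp]
  · simp

theorem sum_prod_mul_apply_mul_apply (p : ι → α → ℝ) (hp : ∀ i, ∑ a, p i a = 1) {i k : ι}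
    (hik : i ≠ k) (g h : α → ℝ) :
    ∑ x : ι → α, (∏ j, p j (x j)) * (g (x i) * h (x k))
      = (∑ a, p i a * g a) * ∑ a, p k a * h a := by
  have e : ∀ x : ι → α, (∏ j, p j (x j)) * (g (x i) * h (x k))
      = ∏ j, p j (x j) * ((if j = i then g (x j) else 1) * (if j = k then h (x j) else 1)) := by
    intro x
    rw [Finset.prod_mul_distrib, Finset.prod_mul_distrib,
      Finset.prod_ite_eq' Finset.univ i (fun j => g (x j)),
      Finset.prod_ite_eq' Finset.univ k (fun j => h (x j))]
    simp
  simp_rw [e]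
  rw [← Fintype.prod_sum fun j a =>
      p j a * ((if j = i then g a else 1) * (if j = k then h a else 1)),
    Fintype.prod_eq_mul i k hik]
  · simp [hik, hik.symm]
  · intro j hj
    simp [hj.1, hj.2, hp]

theorem sum_prod_eq_one (p : ι → α → ℝ) (hp : ∀ i, ∑ a, p i a = 1) :
    ∑ x : ι → α, ∏ j, p j (x j) = 1 := by
  rw [← Fintype.prod_sum p]
  simp [hp]

/-- A weighted average is at least one of its values. -/
theorem exists_le_weighted_sum (p : α → ℝ) (hp0 : ∀ a, 0 ≤ p a) (hp : ∑ a, p a = 1)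
    (g : α → ℝ) : ∃ a, g a ≤ ∑ a, p a * g a := by
  by_contra! h
  set m := ∑ a, p a * g a with hm
  have h1 : ∑ a, p a * m = m := by rw [← Finset.sum_mul, hp, one_mul]
  obtain ⟨a, ha⟩ : ∃ a, 0 < p a := by
    by_contra! hc
    have : ∑ a, p a ≤ 0 := Finset.sum_nonpos fun a _ => hc a
    linarith
  have : ∑ a, p a * m < ∑ a, p a * g a :=
    Finset.sum_lt_sum (fun b _ => mul_le_mul_of_nonneg_left (h b).le (hp0 b))
      ⟨a, Finset.mem_univ _, mul_lt_mul_of_pos_left (h a) ha⟩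
  linarith

end ProductSums

/-! ### Memoryless channels and the converse bound on the rate. -/

section MemorylessChannel

variable {A B : Type} [Fintype B]

/-- The probability of the output word `b` of the memoryless channel `W` with input word `x`. -/
noncomputable def wordLaw (W : A → B → ℝ) {n : ℕ} (x : Fin n → A) (b : Fin n → B) : ℝ := ∏ i, W (x i) (b i)

/-- A stochastic matrix, that is, the transition law of a channel. -/
structure IsChannel (W : A → B → ℝ) : Prop where
  nonneg : ∀ a b, 0 ≤ W a b
  sum : ∀ a, ∑ b, W a b = 1

/-- The output law of the channel `W` with input law `P`. -/
noncomputable def outLaw [Fintype A] (P : A → ℝ) (W : A → B → ℝ) (b : B) : ℝ := ∑ a, P a * W a b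

/-- The mutual information, in nats, between the input with law `P` and the output of `W`. -/
noncomputable def infoNats [Fintype A] (P : A → ℝ) (W : A → B → ℝ) : ℝ :=
  ∑ a, P a * ∑ b, W a b * Real.log (W a b / outLaw P W b)

theorem IsChannel.wordLaw_nonneg {W : A → B → ℝ} (hW : IsChannel W) {n : ℕ} (x : Fin n → A)
    (b : Fin n → B) : 0 ≤ wordLaw W x b :=
  Finset.prod_nonneg fun _ _ => hW.nonneg _ _

theorem IsChannel.sum_wordLaw {W : A → B → ℝ} (hW : IsChannel W) {n : ℕ} (x : Fin n → A) :
    ∑ b, wordLaw W x b = 1 :=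
  sum_prod_eq_one (fun i => W (x i)) fun _ => hW.sum _

theorem outLaw_nonneg [Fintype A] {P : A → ℝ} {W : A → B → ℝ} (hP : ∀ a, 0 ≤ P a)
    (hW : IsChannel W) (b : B) : 0 ≤ outLaw P W b :=
  Finset.sum_nonneg fun a _ => mul_nonneg (hP a) (hW.nonneg a b)

theorem sum_outLaw [Fintype A] {P : A → ℝ} {W : A → B → ℝ} (hP : ∑ a, P a = 1)
    (hW : IsChannel W) : ∑ b, outLaw P W b = 1 := by
  unfold outLaw
  rw [Finset.sum_comm]
  simp [← Finset.mul_sum, hW.sum, hP]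

theorem outLaw_pos [Fintype A] {P : A → ℝ} {W : A → B → ℝ} (hP : ∀ a, 0 ≤ P a)
    (hW : IsChannel W) {a : A} {b : B} (ha : 0 < P a) (hb : W a b ≠ 0) : 0 < outLaw P W b :=
  Finset.sum_pos' (fun a _ => mul_nonneg (hP a) (hW.nonneg a b))
    ⟨a, Finset.mem_univ _, mul_pos ha (lt_of_le_of_ne (hW.nonneg a b) hb.symm)⟩

/-- This is `log t ≤ t - 1` at t = Q exp(g) / P. Summed over outcomes it gives the variational bound
on a divergence, which takes the place of Fano's inequality below. -/
theorem mul_sub_log_div_le {P Q : ℝ} (g : ℝ) (hP : 0 ≤ P) (hQ : 0 ≤ Q) (hPQ : P ≠ 0 → Q ≠ 0) :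
    P * (g - Real.log (P / Q)) ≤ Q * Real.exp g - P := by
  rcases hP.eq_or_lt with rfl | hP
  · simpa using mul_nonneg hQ (Real.exp_pos g).le
  · have hQ' : 0 < Q := lt_of_le_of_ne hQ (hPQ hP.ne').symm
    have h := Real.log_le_sub_one_of_pos (div_pos (mul_pos hQ' (Real.exp_pos g)) hP)
    rw [Real.log_div (by positivity) hP.ne', Real.log_mul hQ'.ne' (Real.exp_pos g).ne',
      Real.log_exp] at h
    rw [Real.log_div hP.ne' hQ'.ne']
    calc P * (g - (Real.log P - Real.log Q)) = P * (Real.log Q + g - Real.log P) := by ring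
      _ ≤ P * (Q * Real.exp g / P - 1) := mul_le_mul_of_nonneg_left h hP.le
      _ = Q * Real.exp g - P := by field_simp

/-- The divergence between product laws is the sum of the divergences of the factors. -/
theorem sum_wordLaw_mul_log {W : A → B → ℝ} (hW : IsChannel W) {n : ℕ} (x : Fin n → A)
    (Q : B → ℝ) (hQ : ∀ i b, W (x i) b ≠ 0 → Q b ≠ 0) :
    ∑ b : Fin n → B, wordLaw W x b * Real.log (wordLaw W x b / ∏ i, Q (b i))
      = ∑ i, ∑ b, W (x i) b * Real.log (W (x i) b / Q b) := by
  have h : ∀ b : Fin n → B, wordLaw W x b * Real.log (wordLaw W x b / ∏ i, Q (b i))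
      = ∑ i, wordLaw W x b * Real.log (W (x i) (b i) / Q (b i)) := by
    intro b
    by_cases hb : wordLaw W x b = 0
    · simp [hb]
    · have hne : ∀ i, W (x i) (b i) ≠ 0 := fun i => Finset.prod_ne_zero_iff.1 hb i (Finset.mem_univ _)
      rw [← Finset.mul_sum]
      congr 1
      rw [wordLaw, ← Finset.prod_div_distrib,
        Real.log_prod fun i _ => div_ne_zero (hne i) (hQ i _ (hne i))]
  simp_rw [h]
  rw [Finset.sum_comm]
  refine Finset.sum_congr rfl fun i _ => ?_
  exact sum_prod_mul_apply (fun j => W (x j)) (fun _ => hW.sum _) i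
    (fun β => Real.log (W (x i) β / Q β))

/-- The variational bound is applied to each codeword with g = log M on the event of correct
decoding and 0 elsewhere. Then exp g is at most 1 + M times the indicator of that event. The
decoding sets partition the output words, so their masses under the reference product law add up to
1 and the total excess is M. -/
theorem log_card_mul_sum_correct_le {W : A → B → ℝ} (hW : IsChannel W) {M n : ℕ} (hM : 0 < M)
    (x : Fin M → Fin n → A) (dec : (Fin n → B) → Fin M) (Q : B → ℝ) (hQ0 : ∀ b, 0 ≤ Q b)
    (hQ1 : ∑ b, Q b = 1) (hQ : ∀ w i b, W (x w i) b ≠ 0 → Q b ≠ 0) :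
    Real.log M * ∑ w, ∑ b, wordLaw W (x w) b * (if dec b = w then 1 else 0)
      ≤ ∑ w, ∑ i, ∑ b, W (x w i) b * Real.log (W (x w i) b / Q b) + M := by
  have hM' : (0 : ℝ) < M := by exact_mod_cast hM
  have hQs : ∑ b : Fin n → B, ∏ i, Q (b i) = 1 :=
    sum_prod_eq_one (fun _ => Q) fun _ => hQ1
  have key : ∀ w (b : Fin n → B),
      wordLaw W (x w) b * ((if dec b = w then Real.log M else 0)
          - Real.log (wordLaw W (x w) b / ∏ i, Q (b i)))
        ≤ (∏ i, Q (b i)) + M * ((∏ i, Q (b i)) * (if dec b = w then 1 else 0))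
          - wordLaw W (x w) b := by
    intro w b
    have hq : 0 ≤ ∏ i, Q (b i) := Finset.prod_nonneg fun i _ => hQ0 _
    refine (mul_sub_log_div_le _ (hW.wordLaw_nonneg _ _) hq ?_).trans ?_
    · intro h
      exact Finset.prod_ne_zero_iff.2 fun i _ =>
        hQ w i _ (Finset.prod_ne_zero_iff.1 h i (Finset.mem_univ _))
    · split_ifs
      · rw [Real.exp_log hM']
        linarith
      · simp
  have hsum := Finset.sum_le_sum fun w (_ : w ∈ Finset.univ) =>
    Finset.sum_le_sum fun b (_ : b ∈ Finset.univ) => key w b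
  have hdec : ∑ w : Fin M, ∑ b : Fin n → B, (∏ i, Q (b i)) * (if dec b = w then (1 : ℝ) else 0)
      = 1 := by
    rw [Finset.sum_comm]
    simpa using hQs
  simp only [Finset.sum_sub_distrib, Finset.sum_add_distrib, mul_sub, ← Finset.mul_sum, hQs, hdec,
    hW.sum_wordLaw, sum_wordLaw_mul_log hW _ Q (hQ _)] at hsum
  have hl : Real.log M * ∑ w, ∑ b, wordLaw W (x w) b * (if dec b = w then 1 else 0)
      = ∑ w, ∑ b, wordLaw W (x w) b * (if dec b = w then Real.log M else 0) := by
    simp [Finset.mul_sum, mul_comm]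
  rw [hl]
  simp at hsum
  simp
  linarith

/-- The empirical distribution of the letters of a codebook. -/
noncomputable def codeType [DecidableEq A] {M n : ℕ} (x : Fin M → Fin n → A) (a : A) : ℝ :=
  (∑ w, ∑ i, if x w i = a then 1 else 0) / (M * n)

section CodeType

variable [DecidableEq A] {M n : ℕ} (x : Fin M → Fin n → A)

theorem codeType_nonneg (a : A) : 0 ≤ codeType x a := by
  unfold codeType
  refine div_nonneg (Finset.sum_nonneg fun w _ => Finset.sum_nonneg fun i _ => ?_) (by positivity)
  split_ifs <;> norm_num

theorem sum_codeType_mul [Fintype A] (hM : 0 < M) (hn : 0 < n) (g : A → ℝ) :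
    ∑ w, ∑ i, g (x w i) = M * n * ∑ a, codeType x a * g a := by
  have h : (M * n : ℝ) ≠ 0 := by positivity
  have e : ∀ a, codeType x a * g a
      = (∑ w, ∑ i, if x w i = a then g a else 0) / (M * n) := by
    intro a
    rw [codeType, div_mul_eq_mul_div, Finset.sum_mul]
    simp only [Finset.sum_mul, ite_mul, one_mul, zero_mul]
  simp_rw [e]
  rw [← Finset.sum_div, mul_div_cancel₀ _ h]
  symm
  rw [Finset.sum_comm]
  refine Finset.sum_congr rfl fun w _ => ?_
  rw [Finset.sum_comm]
  simp

theorem sum_codeType [Fintype A] (hM : 0 < M) (hn : 0 < n) : ∑ a, codeType x a = 1 := by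
  have h := sum_codeType_mul x hM hn (fun _ => 1)
  simp only [Finset.sum_const, Finset.card_univ, Fintype.card_fin, mul_one, nsmul_eq_mul] at h
  have h0 : (M * n : ℝ) ≠ 0 := by positivity
  exact (mul_eq_left₀ h0).1 h.symm

theorem codeType_apply_pos (hM : 0 < M) (hn : 0 < n) (w : Fin M) (i : Fin n) :
    0 < codeType x (x w i) := by
  unfold codeType
  refine div_pos ?_ (by positivity)
  have hnn : ∀ w' i', (0 : ℝ) ≤ if x w' i' = x w i then 1 else 0 := by
    intro w' i'
    split_ifs <;> norm_num
  exact Finset.sum_pos' (fun w' _ => Finset.sum_nonneg fun i' _ => hnn w' i')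
    ⟨w, Finset.mem_univ _, Finset.sum_pos' (fun i' _ => hnn w i')
      ⟨i, Finset.mem_univ _, by simp⟩⟩

/-- Converse: the rate of a code is bounded by the mutual information at its type. -/
theorem log_card_mul_correct_le_infoNats [Fintype A] {W : A → B → ℝ} (hW : IsChannel W) (hM : 0 < M)
    (hn : 0 < n) (dec : (Fin n → B) → Fin M) :
    Real.log M * ((1 / M) * ∑ w, ∑ b, wordLaw W (x w) b * (if dec b = w then 1 else 0))
      ≤ n * infoNats (codeType x) W + 1 := by
  -- With the output law of the codebook's own type as reference, the divergences average exactly to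
  -- the mutual information at that type, so no separate concavity argument is needed.
  have h := log_card_mul_sum_correct_le hW hM x dec (outLaw (codeType x) W)
    (outLaw_nonneg (codeType_nonneg x) hW) (sum_outLaw (sum_codeType x hM hn) hW)
    (fun w i b hb => (outLaw_pos (codeType_nonneg x) hW (codeType_apply_pos x hM hn w i) hb).ne')
  rw [sum_codeType_mul x hM hn
    (fun a => ∑ b, W a b * Real.log (W a b / outLaw (codeType x) W b))] at h
  have hM' : (0 : ℝ) < M := by exact_mod_cast hM
  rw [← mul_le_mul_iff_right₀ hM']
  calc _ = Real.log M * ∑ w, ∑ b, wordLaw W (x w) b * (if dec b = w then 1 else 0) := by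
        field_simp
    _ ≤ _ := h
    _ = _ := by
      unfold infoNats
      ring

end CodeType

end MemorylessChannel

/-! ### Random codebooks and threshold decoding. -/

section RandomCoding

variable {A B : Type} [Fintype A]

/-- A random variable with negative mean has an exponential moment below `1`. -/
theorem exists_sum_mul_exp_lt_one {α : Type} [Fintype α] (c l : α → ℝ) (hc : ∑ a, c a = 1)
    (h : ∑ a, c a * l a < 0) : ∃ s, 0 < s ∧ ∑ a, c a * Real.exp (s * l a) < 1 := by
  have hd : HasDerivAt (fun s : ℝ => ∑ a, c a * Real.exp (s * l a)) (∑ a, c a * l a) 0 := by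
    have : ∀ a ∈ (Finset.univ : Finset α),
        HasDerivAt (fun s : ℝ => c a * Real.exp (s * l a)) (c a * l a) 0 := by
      intro a _
      have h1 : HasDerivAt (fun s : ℝ => s * l a) (l a) 0 := by
        simpa using (hasDerivAt_id (0 : ℝ)).mul_const (l a)
      simpa using (h1.exp).const_mul (c a)
    exact HasDerivAt.fun_sum this
  have hlt := (hasDerivAt_iff_tendsto_slope.1 hd).mono_left
    (nhdsGT_le_nhdsNE 0)
  have hev : ∀ᶠ s in 𝓝[>] (0 : ℝ),
      slope (fun s : ℝ => ∑ a, c a * Real.exp (s * l a)) 0 s < 0 :=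
    hlt.eventually (gt_mem_nhds h)
  obtain ⟨s, hs, hs0⟩ := (hev.and self_mem_nhdsWithin).exists
  have hs0 : (0 : ℝ) < s := hs0
  refine ⟨s, hs0, ?_⟩
  rw [slope_def_field] at hs
  simp only [sub_zero, zero_mul, Real.exp_zero, mul_one, hc] at hs
  have := (div_lt_iff₀ hs0).1 hs
  linarith

/-- The probability of the word `x` with i.i.d. letters of law `P`. -/
noncomputable def iidLaw {A : Type} (P : A → ℝ) {n : ℕ} (x : Fin n → A) : ℝ := ∏ i, P (x i)

theorem iidLaw_nonneg {A : Type} {P : A → ℝ} (hP : ∀ a, 0 ≤ P a) {n : ℕ} (x : Fin n → A) :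
    0 ≤ iidLaw P x :=
  Finset.prod_nonneg fun _ _ => hP _

theorem sum_iidLaw {P : A → ℝ} (hP : ∑ a, P a = 1) {n : ℕ} :
    ∑ x : Fin n → A, iidLaw P x = 1 :=
  sum_prod_eq_one (fun _ => P) fun _ => hP

theorem sum_iidLaw_mul_wordLaw (P : A → ℝ) (W : A → B → ℝ) {n : ℕ} (b : Fin n → B) :
    ∑ x, iidLaw P x * wordLaw W x b = iidLaw (outLaw P W) b := by
  simp only [iidLaw, wordLaw, outLaw, ← Finset.prod_mul_distrib]
  rw [← Fintype.prod_sum fun i a => P a * W a (b i)]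

variable [Fintype B]

/-- The word `x` has likelihood above the threshold `K ^ n` at the output word `b`. -/
def Typical (P : A → ℝ) (W : A → B → ℝ) (K : ℝ) {n : ℕ} (x : Fin n → A) (b : Fin n → B) : Prop :=
  K ^ n * iidLaw (outLaw P W) b < wordLaw W x b

open Classical in
-- Chernoff's method: the letterwise deficit `l` has mean log K - I < 0, hence an exponential moment
-- θ < 1. Atypicality means that the deficits sum to at least 0, so its indicator is at most the
-- exponential of s times that sum, whose expectation factors into θ ^ n.
theorem exists_atypical_le {P : A → ℝ} {W : A → B → ℝ} (hP0 : ∀ a, 0 ≤ P a)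
    (hP1 : ∑ a, P a = 1) (hW : IsChannel W) {K : ℝ}
    (hKI : Real.log K < infoNats P W) :
    ∃ θ, 0 ≤ θ ∧ θ < 1 ∧ ∀ n : ℕ, ∑ x : Fin n → A, iidLaw P x *
      ∑ b, wordLaw W x b * (if Typical P W K x b then 0 else 1) ≤ θ ^ n := by
  set l : A × B → ℝ := fun t => Real.log K - Real.log (W t.1 t.2 / outLaw P W t.2) with hl
  obtain ⟨s, hs, hlt⟩ := exists_sum_mul_exp_lt_one (fun t : A × B => P t.1 * W t.1 t.2) l
    (by simp [Fintype.sum_prod_type, ← Finset.mul_sum, hW.sum, hP1])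
    (by
      have : ∑ t : A × B, P t.1 * W t.1 t.2 * l t = Real.log K - infoNats P W := by
        simp only [hl, Fintype.sum_prod_type, infoNats, mul_sub, Finset.sum_sub_distrib,
          mul_assoc, ← Finset.mul_sum, ← Finset.sum_mul, hW.sum, hP1, one_mul]
      rw [this]
      linarith)
  refine ⟨_, Finset.sum_nonneg fun t _ => ?_, hlt, fun n => ?_⟩
  · exact mul_nonneg (mul_nonneg (hP0 _) (hW.nonneg _ _)) (Real.exp_pos _).le
  · rw [Fintype.sum_prod_type]
    have e : (∑ a, ∑ b, P a * W a b * Real.exp (s * l (a, b))) ^ n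
        = ∑ x : Fin n → A, ∑ b : Fin n → B,
          ∏ i, P (x i) * W (x i) (b i) * Real.exp (s * l (x i, b i)) := by
      have : ∀ x : Fin n → A, ∑ b : Fin n → B,
          ∏ i, P (x i) * W (x i) (b i) * Real.exp (s * l (x i, b i))
          = ∏ i, ∑ β, P (x i) * W (x i) β * Real.exp (s * l (x i, β)) := fun x =>
        (Fintype.prod_sum fun i β => P (x i) * W (x i) β * Real.exp (s * l (x i, β))).symm
      simp_rw [this]
      rw [← Fintype.prod_sum fun (_ : Fin n) a =>
        ∑ β, P a * W a β * Real.exp (s * l (a, β))]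
      simp
    rw [e]
    refine Finset.sum_le_sum fun x _ => ?_
    rw [Finset.mul_sum]
    refine Finset.sum_le_sum fun b _ => ?_
    rw [Finset.prod_mul_distrib, Finset.prod_mul_distrib, ← mul_assoc, ← Real.exp_sum,
      ← Finset.mul_sum]
    change iidLaw P x * wordLaw W x b * _ ≤ iidLaw P x * wordLaw W x b * _
    have h0 : 0 ≤ iidLaw P x * wordLaw W x b :=
      mul_nonneg (iidLaw_nonneg hP0 x) (hW.wordLaw_nonneg x b)
    -- Pairs of probability zero are discarded first, so that every logarithm below has a nonzero
    -- argument.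
    rcases h0.eq_or_lt with h0' | hpos
    · rw [← h0']
      simp
    refine mul_le_mul_of_nonneg_left ?_ h0
    split_ifs with hT
    · exact (Real.exp_pos _).le
    · refine Real.one_le_exp (mul_nonneg hs.le ?_)
      have hx : ∀ i, P (x i) ≠ 0 := fun i =>
        Finset.prod_ne_zero_iff.1 (left_ne_zero_of_mul hpos.ne') i (Finset.mem_univ _)
      have hw : ∀ i, W (x i) (b i) ≠ 0 := fun i =>
        Finset.prod_ne_zero_iff.1 (right_ne_zero_of_mul hpos.ne') i (Finset.mem_univ _)
      have hq : ∀ i, 0 < outLaw P W (b i) := fun i =>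
        outLaw_pos hP0 hW (lt_of_le_of_ne (hP0 _) (hx i).symm) (hw i)
      have hw' : 0 < wordLaw W x b :=
        lt_of_le_of_ne (hW.wordLaw_nonneg x b) (right_ne_zero_of_mul hpos.ne').symm
      have hq' : 0 < iidLaw (outLaw P W) b := Finset.prod_pos fun i _ => hq i
      have hle : wordLaw W x b / iidLaw (outLaw P W) b ≤ K ^ n := by
        rw [div_le_iff₀ hq']
        exact not_lt.1 hT
      have := Real.log_le_log (div_pos hw' hq') hle
      rw [Real.log_pow, wordLaw, iidLaw, ← Finset.prod_div_distrib,
        Real.log_prod fun i _ => div_ne_zero (hw i) (hq i).ne'] at this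
      simp only [hl, Finset.sum_sub_distrib, Finset.sum_const, Finset.card_univ,
        Fintype.card_fin, nsmul_eq_mul]
      linarith

open Classical in
/-- The bound on the error indicator of a threshold decoder when message `w` is sent. -/
noncomputable def confusion {M : ℕ} (T : Fin M → Prop) (w : Fin M) : ℝ :=
  (if T w then 0 else 1) + ∑ w', if w' ≠ w ∧ T w' then 1 else 0

/-- Decode to any message that passes the test. A wrong choice is itself a false alarm counted by
`confusion`; if no message passes, the true one fails its own test. -/
theorem exists_decoder_le_confusion {M : ℕ} (hM : 0 < M) {β : Type} (T : β → Fin M → Prop) :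
    ∃ dec : β → Fin M, ∀ w b, (if dec b = w then (0 : ℝ) else 1) ≤ confusion (T b) w := by
  classical
  have : ∀ b, ∃ v : Fin M, ∀ w, (if v = w then (0 : ℝ) else 1) ≤ confusion (T b) w := by
    intro b
    have hnn : ∀ w w', (0 : ℝ) ≤ if w' ≠ w ∧ T b w' then 1 else 0 := by
      intro w w'
      split_ifs <;> norm_num
    by_cases h : ∃ v, T b v
    · obtain ⟨v, hv⟩ := h
      refine ⟨v, fun w => ?_⟩
      unfold confusion
      have h1 := Finset.sum_nonneg fun w' (_ : w' ∈ Finset.univ) => hnn w w'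
      by_cases hvw : v = w
      · rw [if_pos hvw]
        split_ifs <;> linarith
      · have h2 := Finset.single_le_sum (fun w' _ => hnn w w') (Finset.mem_univ v)
        rw [if_pos ⟨hvw, hv⟩] at h2
        rw [if_neg hvw]
        split_ifs <;> linarith
    · push Not at h
      refine ⟨⟨0, hM⟩, fun w => ?_⟩
      simp only [confusion, h, and_false, if_false, Finset.sum_const_zero]
      split_ifs <;> norm_num
  choose dec hdec using this
  exact ⟨dec, fun w b => hdec b w⟩

open Classical in
-- Change of measure: on the typical event the output law is at most K ^ (-n) times the channel law,
-- and the channel law has total mass 1. This bounds the chance that an independent codeword looks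
-- typical.
theorem sum_typical_le {P : A → ℝ} {W : A → B → ℝ} (hP0 : ∀ a, 0 ≤ P a)
    (hP1 : ∑ a, P a = 1) (hW : IsChannel W) {K : ℝ} (hK : 0 < K) (n : ℕ) :
    ∑ b : Fin n → B, iidLaw (outLaw P W) b *
      ∑ x : Fin n → A, iidLaw P x * (if Typical P W K x b then 1 else 0) ≤ (K ^ n)⁻¹ := by
  have hKn : 0 < K ^ n := pow_pos hK n
  have h : ∀ (b : Fin n → B) (x : Fin n → A),
      iidLaw (outLaw P W) b * (iidLaw P x * (if Typical P W K x b then 1 else 0))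
        ≤ (K ^ n)⁻¹ * (iidLaw P x * wordLaw W x b) := by
    intro b x
    have hp := iidLaw_nonneg hP0 x
    have hw := hW.wordLaw_nonneg x b
    split_ifs with hT
    · have : iidLaw (outLaw P W) b ≤ (K ^ n)⁻¹ * wordLaw W x b := by
        rw [← div_eq_inv_mul, le_div_iff₀ hKn, mul_comm]
        exact le_of_lt hT
      calc _ = iidLaw P x * iidLaw (outLaw P W) b := by ring
        _ ≤ iidLaw P x * ((K ^ n)⁻¹ * wordLaw W x b) := mul_le_mul_of_nonneg_left this hp
        _ = _ := by ring
    · simpa using mul_nonneg (inv_nonneg.2 hKn.le) (mul_nonneg hp hw)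
  calc _ ≤ ∑ b : Fin n → B, ∑ x : Fin n → A, (K ^ n)⁻¹ * (iidLaw P x * wordLaw W x b) := by
        refine Finset.sum_le_sum fun b _ => ?_
        rw [Finset.mul_sum]
        exact Finset.sum_le_sum fun x _ => h b x
    _ = (K ^ n)⁻¹ := by
        rw [Finset.sum_comm]
        simp only [← Finset.mul_sum, hW.sum_wordLaw, mul_one, sum_iidLaw hP1]

/-- The law of a random codebook with i.i.d. letters. -/
noncomputable def codebookLaw {A : Type} (P : A → ℝ) {M n : ℕ} (C : Fin M → Fin n → A) : ℝ := ∏ w, iidLaw P (C w)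

open Classical in
/-- Average error of threshold decoding over random codebooks. -/
theorem sum_codebookLaw_mul_confusion_le {P : A → ℝ} {W : A → B → ℝ} (hP0 : ∀ a, 0 ≤ P a)
    (hP1 : ∑ a, P a = 1) (hW : IsChannel W) {K : ℝ} (hK : 0 < K) {M n : ℕ} (w : Fin M) {δ : ℝ}
    (hδ : ∑ x : Fin n → A, iidLaw P x *
      ∑ b, wordLaw W x b * (if Typical P W K x b then 0 else 1) ≤ δ) :
    ∑ C : Fin M → Fin n → A, codebookLaw P C *
      ∑ b, wordLaw W (C w) b * confusion (fun v => Typical P W K (C v) b) w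
      ≤ δ + M * (K ^ n)⁻¹ := by
  have hKn : 0 ≤ (K ^ n)⁻¹ := inv_nonneg.2 (pow_pos hK n).le
  have hs : ∑ x : Fin n → A, iidLaw P x = 1 := sum_iidLaw hP1
  have h1 := sum_prod_mul_apply (fun _ : Fin M => iidLaw P (n := n)) (fun _ => hs) w
    (fun x => ∑ b, wordLaw W x b * (if Typical P W K x b then 0 else 1))
  have h2 : ∀ w', ∑ C : Fin M → Fin n → A, codebookLaw P C *
      ∑ b, wordLaw W (C w) b * (if w' ≠ w ∧ Typical P W K (C w') b then 1 else 0)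
        ≤ (K ^ n)⁻¹ := by
    intro w'
    by_cases hw : w' = w
    · simpa [hw] using hKn
    · refine le_trans (le_of_eq ?_) (sum_typical_le hP0 hP1 hW hK n)
      simp_rw [Finset.mul_sum]
      rw [Finset.sum_comm]
      refine Finset.sum_congr rfl fun b _ => ?_
      -- Distinct codewords are independent; averaging over the transmitted one leaves the i.i.d.
      -- output law.
      have := sum_prod_mul_apply_mul_apply (fun _ : Fin M => iidLaw P (n := n)) (fun _ => hs)
        (Ne.symm hw) (fun x => wordLaw W x b) (fun x => if Typical P W K x b then 1 else 0)
      rw [sum_iidLaw_mul_wordLaw] at this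
      simpa [hw, codebookLaw, Finset.mul_sum] using this
  have h3 := Finset.sum_le_sum fun w' (_ : w' ∈ Finset.univ) => h2 w'
  rw [Finset.sum_comm] at h3
  simp only [Finset.sum_const, Finset.card_univ, Fintype.card_fin, nsmul_eq_mul] at h3
  have h4 : ∀ C : Fin M → Fin n → A, codebookLaw P C *
      ∑ b, wordLaw W (C w) b * confusion (fun v => Typical P W K (C v) b) w
      = codebookLaw P C * (∑ b, wordLaw W (C w) b * (if Typical P W K (C w) b then 0 else 1))
        + ∑ w', codebookLaw P C *
          ∑ b, wordLaw W (C w) b * (if w' ≠ w ∧ Typical P W K (C w') b then 1 else 0) := by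
    intro C
    rw [← Finset.mul_sum, ← mul_add, Finset.sum_comm, ← Finset.sum_add_distrib]
    simp only [confusion, mul_add, Finset.mul_sum]
  simp_rw [h4]
  rw [Finset.sum_add_distrib]
  exact add_le_add (h1.le.trans hδ) h3

end RandomCoding

/-! ### Channels seen through a function of the output. -/

section Pushforward

variable {A O B : Type} [Fintype O] [Fintype B] [DecidableEq B]

/-- The channel obtained from `W` by applying `h` to the output. -/
def pushLaw (W : A → O → ℝ) (h : O → B) (a : A) (b : B) : ℝ := ∑ o, if h o = b then W a o else 0

theorem IsChannel.pushLaw {W : A → O → ℝ} (hW : IsChannel W) (h : O → B) :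
    IsChannel (pushLaw W h) where
  nonneg a b := Finset.sum_nonneg fun o _ => by
    split_ifs
    · exact hW.nonneg a o
    · exact le_rfl
  sum a := by
    unfold _root_.pushLaw
    rw [Finset.sum_comm]
    simpa using hW.sum a

/-- This lets events of both receivers be evaluated on the joint law of states and outputs. -/
theorem sum_wordLaw_pushLaw (W : A → O → ℝ) (h : O → B) {n : ℕ} (x : Fin n → A)
    (g : (Fin n → B) → ℝ) :
    ∑ b, wordLaw (pushLaw W h) x b * g b = ∑ o, wordLaw W x o * g (fun i => h (o i)) := by
  have e : ∀ b : Fin n → B, wordLaw (pushLaw W h) x b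
      = ∑ o : Fin n → O, if (fun i => h (o i)) = b then wordLaw W x o else 0 := by
    intro b
    unfold wordLaw pushLaw
    rw [Fintype.prod_sum fun i o => if h o = b i then W (x i) o else 0]
    refine Finset.sum_congr rfl fun o _ => ?_
    rw [Finset.prod_ite_zero]
    simp [funext_iff]
  simp_rw [e, Finset.sum_mul]
  rw [Finset.sum_comm]
  simp

end Pushforward

/-! ### The two receivers' channels as marginals of one joint channel. -/

namespace SDMBC

variable {X S Y Z : Type} [Fintype S] [Fintype Y] [Fintype Z]

/-- The channel whose output is the state together with both channel outputs. -/
def fullLaw (ch : SDMBC X S Y Z) (x : X) (o : S × Y × Z) : ℝ :=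
  ch.PS o.1 * ch.trans x o.1 o.2.1 o.2.2

theorem isChannel_fullLaw (ch : SDMBC X S Y Z) : IsChannel ch.fullLaw where
  nonneg x o := mul_nonneg (ch.PS_nonneg _) (ch.trans_nonneg _ _ _ _)
  sum x := by
    simp only [fullLaw, Fintype.sum_prod_type, ← Finset.mul_sum, ch.trans_sum, mul_one, ch.PS_sum]

theorem sum_blockProb_mul (ch : SDMBC X S Y Z) {n : ℕ} (x : Fin n → X)
    (F : (Fin n → S) → (Fin n → Y) → (Fin n → Z) → ℝ) :
    ∑ s, ∑ y, ∑ z, ch.blockProb x s y z * F s y z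
      = ∑ o, wordLaw ch.fullLaw x o *
          F (fun i => (o i).1) (fun i => (o i).2.1) (fun i => (o i).2.2) := by
  let e : (Fin n → S × Y × Z) ≃ (Fin n → S) × (Fin n → Y) × (Fin n → Z) :=
    (Equiv.arrowProdEquivProdArrow (Fin n) (fun _ => S) (fun _ => Y × Z)).trans
      ((Equiv.refl _).prodCongr (Equiv.arrowProdEquivProdArrow (Fin n) (fun _ => Y) (fun _ => Z)))
  have h : ∑ s, ∑ y, ∑ z, ch.blockProb x s y z * F s y z
      = ∑ t : (Fin n → S) × (Fin n → Y) × (Fin n → Z),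
        ch.blockProb x t.1 t.2.1 t.2.2 * F t.1 t.2.1 t.2.2 := by
    simp only [Fintype.sum_prod_type]
  rw [h]
  exact (Fintype.sum_equiv e _ _ fun o => rfl).symm

/-- The channel to the communication receiver, which also observes the state. -/
def commLaw [DecidableEq S] [DecidableEq Y] (ch : SDMBC X S Y Z) : X → Y × S → ℝ :=
  pushLaw ch.fullLaw fun o => (o.2.1, o.1)

/-- The channel to the sensing receiver. -/
def senseLaw [DecidableEq Z] (ch : SDMBC X S Y Z) : X → Z → ℝ :=
  pushLaw ch.fullLaw fun o => o.2.2

theorem isChannel_commLaw [DecidableEq S] [DecidableEq Y] (ch : SDMBC X S Y Z) :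
    IsChannel ch.commLaw :=
  ch.isChannel_fullLaw.pushLaw _

theorem isChannel_senseLaw [DecidableEq Z] (ch : SDMBC X S Y Z) : IsChannel ch.senseLaw :=
  ch.isChannel_fullLaw.pushLaw _

theorem errorProb_nonneg (ch : SDMBC X S Y Z) {M0 M1 n : ℕ} (c : DMSCode X S Y Z M0 M1 n) :
    0 ≤ ch.errorProb c := by
  classical
  unfold errorProb
  refine mul_nonneg (by positivity) (Finset.sum_nonneg fun w0 _ => Finset.sum_nonneg fun w1 _ => ?_)
  rw [ch.sum_blockProb_mul]
  refine Finset.sum_nonneg fun o _ => mul_nonneg (ch.isChannel_fullLaw.wordLaw_nonneg _ _) ?_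
  split_ifs <;> norm_num

theorem distortion_nonneg (ch : SDMBC X S Y Z) {M0 M1 n : ℕ} (c : DMSCode X S Y Z M0 M1 n) :
    0 ≤ ch.distortion c := by
  unfold distortion
  refine mul_nonneg (by positivity) (Finset.sum_nonneg fun w0 _ => Finset.sum_nonneg fun w1 _ => ?_)
  rw [ch.sum_blockProb_mul]
  exact Finset.sum_nonneg fun o _ => mul_nonneg (ch.isChannel_fullLaw.wordLaw_nonneg _ _)
    (mul_nonneg (by positivity) (Finset.sum_nonneg fun i _ => ch.dist_nonneg _ _))

/-- The upper bound makes the real-valued `limsup` in `Achievable` meaningful: the converse uses it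
to extract eventual bounds. -/
theorem distortion_le_one (ch : SDMBC X S Y Z) (hd : ∀ s s', ch.dist s s' ≤ 1) {M n : ℕ}
    (c : DMSCode X S Y Z M 1 n) : ch.distortion c ≤ 1 := by
  have h : ∀ w0 : Fin M, ∀ w1 : Fin 1, ∑ s, ∑ y, ∑ z, ch.blockProb (c.enc w0 w1) s y z *
      ((1 / (n : ℝ)) * ∑ i, ch.dist (s i) (c.est z i)) ≤ 1 := by
    intro w0 w1
    rw [ch.sum_blockProb_mul]
    refine le_trans (Finset.sum_le_sum fun o _ =>
      mul_le_of_le_one_right (ch.isChannel_fullLaw.wordLaw_nonneg _ _) ?_)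
      (ch.isChannel_fullLaw.sum_wordLaw (c.enc w0 w1)).le
    have h1 := Finset.sum_le_sum fun i (_ : i ∈ (Finset.univ : Finset (Fin n))) =>
      hd (o i).1 (c.est (fun i => (o i).2.2) i)
    simp only [Finset.sum_const, Finset.card_univ, Fintype.card_fin, nsmul_eq_mul, mul_one] at h1
    rw [one_div, ← div_eq_inv_mul]
    exact div_le_one_of_le₀ h1 (by positivity)
  have h2 := Finset.sum_le_sum fun w0 (_ : w0 ∈ Finset.univ) =>
    Finset.sum_le_sum fun w1 (_ : w1 ∈ Finset.univ) => h w0 w1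
  unfold distortion
  simp only [Finset.sum_const, Finset.card_univ, Fintype.card_fin, nsmul_eq_mul, mul_one] at h2
  rw [one_div, ← div_eq_inv_mul]
  refine div_le_one_of_le₀ (h2.trans (by simp)) (by positivity)

/-! ### Converse for rate and distortion at the type of the codebook. -/

section Converse

/-- Joint success implies success at each receiver; `good` is later taken to be correct decoding at
one receiver, so both rate bounds come from this lemma. -/
theorem one_sub_errorProb_le (ch : SDMBC X S Y Z) {M n : ℕ} (hM : 0 < M)
    (c : DMSCode X S Y Z M 1 n) (good : Fin M → (Fin n → S × Y × Z) → Prop)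
    [∀ w o, Decidable (good w o)]
    (hg : ∀ w o, c.dec1 (fun i => (o i).2.1) (fun i => (o i).1) = (w, 0) →
      c.dec2 (fun i => (o i).2.2) = w → good w o) :
    1 - ch.errorProb c
      ≤ (1 / M) * ∑ w, ∑ o, wordLaw ch.fullLaw (c.enc w 0) o * (if good w o then 1 else 0) := by
  have hM' : (0 : ℝ) < M := by exact_mod_cast hM
  have h : ∀ w, 1 - ∑ s, ∑ y, ∑ z, ch.blockProb (c.enc w 0) s y z *
        (if c.dec1 y s ≠ (w, 0) ∨ c.dec2 z ≠ w then 1 else 0)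
      ≤ ∑ o, wordLaw ch.fullLaw (c.enc w 0) o * (if good w o then 1 else 0) := by
    intro w
    rw [ch.sum_blockProb_mul]
    conv_lhs => lhs; rw [← ch.isChannel_fullLaw.sum_wordLaw (c.enc w 0)]
    rw [← Finset.sum_sub_distrib]
    refine Finset.sum_le_sum fun o _ => ?_
    have h0 := ch.isChannel_fullLaw.wordLaw_nonneg (c.enc w 0) o
    by_cases hw : good w o
    · rw [if_pos hw]
      split_ifs <;> linarith
    · have : c.dec1 (fun i => (o i).2.1) (fun i => (o i).1) ≠ (w, 0) ∨
          c.dec2 (fun i => (o i).2.2) ≠ w := by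
        by_contra! hc
        exact hw (hg w o hc.1 hc.2)
      rw [if_pos this, if_neg hw]
      linarith
  have h2 := Finset.sum_le_sum fun w (_ : w ∈ Finset.univ) => h w
  rw [Finset.sum_sub_distrib] at h2
  simp only [Finset.sum_const, Finset.card_univ, Fintype.card_fin, nsmul_eq_mul, mul_one] at h2
  have h3 := mul_le_mul_of_nonneg_left h2 (one_div_pos.2 hM').le
  rw [mul_sub, one_div_mul_cancel hM'.ne'] at h3
  refine le_trans (le_of_eq ?_) h3
  simp [errorProb]

theorem log_card_mul_le_commLaw [Fintype X] [DecidableEq X] [DecidableEq S] [DecidableEq Y]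
    (ch : SDMBC X S Y Z) {M n : ℕ} (hM : 0 < M) (hn : 0 < n)
    (c : DMSCode X S Y Z M 1 n) :
    Real.log M * (1 - ch.errorProb c)
      ≤ n * infoNats (codeType fun w => c.enc w 0) ch.commLaw + 1 := by
  have h := log_card_mul_correct_le_infoNats (fun w => c.enc w 0) ch.isChannel_commLaw hM hn
    (fun b => (c.dec1 (fun i => (b i).1) fun i => (b i).2).1)
  refine le_trans (mul_le_mul_of_nonneg_left ?_ (Real.log_natCast_nonneg M)) h
  simp only [commLaw]
  simp_rw [sum_wordLaw_pushLaw]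
  exact ch.one_sub_errorProb_le hM c _ fun w o h1 _ => by rw [h1]

theorem log_card_mul_le_senseLaw [Fintype X] [DecidableEq X] [DecidableEq Z]
    (ch : SDMBC X S Y Z) {M n : ℕ} (hM : 0 < M) (hn : 0 < n)
    (c : DMSCode X S Y Z M 1 n) :
    Real.log M * (1 - ch.errorProb c)
      ≤ n * infoNats (codeType fun w => c.enc w 0) ch.senseLaw + 1 := by
  have h := log_card_mul_correct_le_infoNats (fun w => c.enc w 0) ch.isChannel_senseLaw hM hn
    c.dec2
  refine le_trans (mul_le_mul_of_nonneg_left ?_ (Real.log_natCast_nonneg M)) h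
  simp only [senseLaw]
  simp_rw [sum_wordLaw_pushLaw]
  exact ch.one_sub_errorProb_le hM c _ fun w o _ h2 => h2

/-- The hypothesis on `δ` says that even knowing x, y and z at one position, no guess of the state
does better than `δ x`. With both output words fixed, the i-th estimate is a constant and the law of
the states factors over positions, so only the i-th factor changes. -/
theorem le_sum_blockProb_mul_dist (ch : SDMBC X S Y Z) (δ : X → ℝ)
    (hδ0 : ∀ x, 0 ≤ δ x)
    (hδ : ∀ x y z s', δ x * ∑ s, ch.PS s * ch.trans x s y z
      ≤ ∑ s, ch.PS s * ch.trans x s y z * ch.dist s s') {n : ℕ} (x : Fin n → X)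
    (est : (Fin n → Z) → Fin n → S) (i : Fin n) :
    δ (x i) ≤ ∑ s, ∑ y, ∑ z, ch.blockProb x s y z * ch.dist (s i) (est z i) := by
  have hone : ∑ s, ∑ y, ∑ z, ch.blockProb x s y z = 1 := by
    have := ch.sum_blockProb_mul x (fun _ _ _ => 1)
    simpa [ch.isChannel_fullLaw.sum_wordLaw] using this
  have hyz : ∀ (y : Fin n → Y) (z : Fin n → Z), δ (x i) * ∑ s, ch.blockProb x s y z
      ≤ ∑ s, ch.blockProb x s y z * ch.dist (s i) (est z i) := by
    intro y z
    have e1 : ∀ s : Fin n → S, ch.blockProb x s y z * ch.dist (s i) (est z i)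
        = ∏ j, ch.PS (s j) * ch.trans (x j) (s j) (y j) (z j) *
            (if j = i then ch.dist (s j) (est z i) else 1) := by
      intro s
      rw [Finset.prod_mul_distrib,
        Finset.prod_ite_eq' Finset.univ i (fun j => ch.dist (s j) (est z i))]
      simp [blockProb]
    have e2 : δ (x i) * ∑ s, ch.blockProb x s y z
        = ∏ j, (if j = i then δ (x j) else 1) *
          ∑ s, ch.PS s * ch.trans (x j) s (y j) (z j) := by
      rw [Finset.prod_mul_distrib, Finset.prod_ite_eq' Finset.univ i (fun j => δ (x j)),
        Fintype.prod_sum fun j s => ch.PS s * ch.trans (x j) s (y j) (z j)]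
      simp [blockProb]
    simp_rw [e1]
    rw [e2, ← Fintype.prod_sum fun j s => ch.PS s * ch.trans (x j) s (y j) (z j) *
            (if j = i then ch.dist s (est z i) else 1)]
    refine Finset.prod_le_prod (fun j _ => mul_nonneg ?_ (Finset.sum_nonneg fun s _ =>
      mul_nonneg (ch.PS_nonneg s) (ch.trans_nonneg _ _ _ _))) fun j _ => ?_
    · split_ifs
      · exact hδ0 _
      · exact zero_le_one
    · by_cases hj : j = i
      · simpa [hj] using hδ (x i) (y i) (z i) (est z i)
      · simp [hj]
  have hsum := Finset.sum_le_sum fun y (_ : y ∈ Finset.univ) =>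
    Finset.sum_le_sum fun z (_ : z ∈ Finset.univ) => hyz y z
  simp only [← Finset.mul_sum] at hsum
  have hcomm : ∀ F : (Fin n → S) → (Fin n → Y) → (Fin n → Z) → ℝ,
      ∑ y, ∑ z, ∑ s, F s y z = ∑ s, ∑ y, ∑ z, F s y z := by
    intro F
    rw [Finset.sum_comm]
    simp_rw [Finset.sum_comm (s := (Finset.univ : Finset (Fin n → Y)))]
    rw [Finset.sum_comm]
  rw [hcomm, hcomm, hone, mul_one] at hsum
  exact hsum

/-- The letterwise bound is averaged over messages and positions. This average is the type that
appears in the rate bounds, so a single input law controls rate and distortion together. -/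
theorem sum_codeType_mul_le_distortion [Fintype X] [DecidableEq X] (ch : SDMBC X S Y Z) (δ : X → ℝ)
    (hδ0 : ∀ x, 0 ≤ δ x)
    (hδ : ∀ x y z s', δ x * ∑ s, ch.PS s * ch.trans x s y z
      ≤ ∑ s, ch.PS s * ch.trans x s y z * ch.dist s s') {M n : ℕ} (hM : 0 < M) (hn : 0 < n)
    (c : DMSCode X S Y Z M 1 n) :
    ∑ x, codeType (fun w => c.enc w 0) x * δ x ≤ ch.distortion c := by
  have hM' : (0 : ℝ) < M := by exact_mod_cast hM
  have hn' : (0 : ℝ) < n := by exact_mod_cast hn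
  have h1 : ∑ x, codeType (fun w => c.enc w 0) x * δ x
      = (1 / M) * ∑ w, (1 / n) * ∑ i, δ (c.enc w 0 i) := by
    rw [← Finset.mul_sum, sum_codeType_mul (fun w => c.enc w 0) hM hn]
    field_simp
  have h2 : ch.distortion c = (1 / M) * ∑ w, (1 / n) * ∑ i, ∑ s, ∑ y, ∑ z,
      ch.blockProb (c.enc w 0) s y z * ch.dist (s i) (c.est z i) := by
    simp only [distortion, Finset.univ_unique, Fin.default_eq_zero, Finset.sum_singleton,
      Nat.cast_one, mul_one]
    congr 1
    refine Finset.sum_congr rfl fun w _ => ?_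
    have hF := fun i => ch.sum_blockProb_mul (c.enc w 0) fun s _ z => ch.dist (s i) (c.est z i)
    simp_rw [hF]
    rw [ch.sum_blockProb_mul (c.enc w 0)
      fun s _ z => (1 / (n : ℝ)) * ∑ i, ch.dist (s i) (c.est z i), Finset.sum_comm,
      Finset.mul_sum]
    refine Finset.sum_congr rfl fun o _ => ?_
    rw [← Finset.mul_sum]
    ring
  rw [h1, h2]
  refine mul_le_mul_of_nonneg_left (Finset.sum_le_sum fun w _ => mul_le_mul_of_nonneg_left
    (Finset.sum_le_sum fun i _ => ?_) (by positivity)) (by positivity)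
  exact ch.le_sum_blockProb_mul_dist δ hδ0 hδ (c.enc w 0) c.est i

end Converse

end SDMBC

/-! ### Size of the message set. -/

theorem msgCount_zero (n : ℕ) : msgCount 0 n = 1 := by
  simp [msgCount]

theorem msgCount_pos (R : ℝ) (n : ℕ) : 0 < msgCount R n :=
  Nat.ceil_pos.2 (by positivity)

theorem exp_le_msgCount (R : ℝ) (n : ℕ) :
    Real.exp (n * (R * Real.log 2)) ≤ msgCount R n := by
  refine le_trans (le_of_eq ?_) (Nat.le_ceil _)
  rw [Real.rpow_def_of_pos two_pos]
  ring_nf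

/-- Rounding up costs at most a factor 2 because 2 ^ (nR) ≥ 1 for R ≥ 0. -/
theorem msgCount_le {R : ℝ} (hR : 0 ≤ R) (n : ℕ) :
    (msgCount R n : ℝ) ≤ 2 * Real.exp (n * (R * Real.log 2)) := by
  have h1 : (1 : ℝ) ≤ Real.exp (n * (R * Real.log 2)) :=
    Real.one_le_exp (mul_nonneg (Nat.cast_nonneg n)
      (mul_nonneg hR (Real.log_nonneg one_le_two)))
  have h2 := Nat.ceil_lt_add_one (by positivity : 0 ≤ (2 : ℝ) ^ ((n : ℝ) * R))
  have e : (2 : ℝ) ^ ((n : ℝ) * R) = Real.exp (n * (R * Real.log 2)) := by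
    rw [Real.rpow_def_of_pos two_pos]
    ring_nf
  rw [e] at h2
  rw [msgCount, e]
  linarith

namespace SDMBC

variable {X S Y Z : Type} [Fintype S] [Fintype Y] [Fintype Z]

/-! ### Achievability by decoding the codeword and estimating letter by letter. -/

section Achievability

/-- The expected distortion of the letterwise estimator `est` when `x` is sent. -/
def letterDist (ch : SDMBC X S Y Z) (est : X → Z → S) (x : X) : ℝ :=
  ∑ o, ch.fullLaw x o * ch.dist o.1 (est x o.2.2)

theorem sum_wordLaw_mul_letterDist (ch : SDMBC X S Y Z) (est : X → Z → S) {n : ℕ} (x : Fin n → X) :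
    ∑ o, wordLaw ch.fullLaw x o * ((1 / (n : ℝ)) * ∑ i, ch.dist (o i).1 (est (x i) (o i).2.2))
      = (1 / (n : ℝ)) * ∑ i, ch.letterDist est (x i) := by
  simp_rw [Finset.mul_sum]
  rw [Finset.sum_comm]
  refine Finset.sum_congr rfl fun i _ => ?_
  have h := sum_prod_mul_apply (fun j => ch.fullLaw (x j)) (fun _ => ch.isChannel_fullLaw.sum _) i
    (fun o => ch.dist o.1 (est (x i) o.2.2))
  rw [letterDist, ← h, Finset.mul_sum]
  refine Finset.sum_congr rfl fun o _ => ?_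
  rw [wordLaw]
  ring

open Classical in
/-- A codebook gives a code whose error and distortion are controlled by the confusion of the two
threshold decoders and by the distortion of an estimator that knows the codeword. -/
theorem exists_code_le [DecidableEq S] [DecidableEq Y] [DecidableEq Z]
    (ch : SDMBC X S Y Z) (est : X → Z → S) (hd : ∀ s s', ch.dist s s' ≤ 1)
    {M n : ℕ} (hM : 0 < M) (C : Fin M → Fin n → X)
    (T1 : Fin M → (Fin n → Y × S) → Prop) (T2 : Fin M → (Fin n → Z) → Prop) {α : ℝ}
    (hα : 0 ≤ α) :
    ∃ c : DMSCode X S Y Z M 1 n, α * ch.errorProb c + ch.distortion c ≤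
      (1 / M) * ∑ w, ((α + 1) * ((∑ b, wordLaw ch.commLaw (C w) b * confusion (fun v => T1 v b) w)
          + ∑ b, wordLaw ch.senseLaw (C w) b * confusion (fun v => T2 v b) w)
        + (1 / (n : ℝ)) * ∑ i, ch.letterDist est (C w i)) := by
  obtain ⟨d1, hd1⟩ := exists_decoder_le_confusion hM fun (b : Fin n → Y × S) v => T1 v b
  obtain ⟨d2, hd2⟩ := exists_decoder_le_confusion hM fun (b : Fin n → Z) v => T2 v b
  refine ⟨⟨fun w _ => C w, fun y s => (d1 fun i => (y i, s i), 0), d2,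
    fun z i => est (C (d2 z) i) (z i)⟩, ?_⟩
  simp only [errorProb, distortion, Finset.univ_unique, Fin.default_eq_zero,
    Finset.sum_singleton, Nat.cast_one, mul_one, ch.sum_blockProb_mul, commLaw, senseLaw,
    sum_wordLaw_pushLaw]
  rw [mul_left_comm, ← mul_add, Finset.mul_sum, ← Finset.sum_add_distrib]
  refine mul_le_mul_of_nonneg_left (Finset.sum_le_sum fun w _ => ?_) (by positivity)
  rw [← ch.sum_wordLaw_mul_letterDist est (C w), ← Finset.sum_add_distrib, Finset.mul_sum,
    Finset.mul_sum, ← Finset.sum_add_distrib, ← Finset.sum_add_distrib]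
  refine Finset.sum_le_sum fun o _ => ?_
  have hp := ch.isChannel_fullLaw.wordLaw_nonneg (C w) o
  have h1 := hd1 w fun i => ((o i).2.1, (o i).1)
  have h2 := hd2 w fun i => (o i).2.2
  set c1 := confusion (fun v => T1 v fun i => ((o i).2.1, (o i).1)) w
  set c2 := confusion (fun v => T2 v fun i => (o i).2.2) w
  have hc1 : 0 ≤ c1 := le_trans (by split_ifs <;> norm_num) h1
  have hc2 : 0 ≤ c2 := le_trans (by split_ifs <;> norm_num) h2
  have herr : (if ((d1 fun i => ((o i).2.1, (o i).1)), (0 : Fin 1)) ≠ (w, 0) ∨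
      (d2 fun i => (o i).2.2) ≠ w then (1 : ℝ) else 0) ≤ c1 + c2 := by
    by_cases e1 : (d1 fun i => ((o i).2.1, (o i).1)) = w
    · by_cases e2 : (d2 fun i => (o i).2.2) = w
      · rw [if_neg (by simp [e1, e2])]
        linarith
      · rw [if_neg e2] at h2
        split_ifs <;> linarith
    · rw [if_neg e1] at h1
      split_ifs <;> linarith
  -- A wrong sensing decision costs at most 1 in distortion, and then `c2` is at least 1; this is
  -- the source of the 1 in `α + 1`.
  have hdist : (1 / (n : ℝ)) * ∑ i, ch.dist (o i).1
        (est (C (d2 fun i => (o i).2.2) i) (o i).2.2)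
      ≤ c2 + (1 / (n : ℝ)) * ∑ i, ch.dist (o i).1 (est (C w i) (o i).2.2) := by
    by_cases e2 : (d2 fun i => (o i).2.2) = w
    · rw [e2]
      linarith
    · rw [if_neg e2] at h2
      have hn : (0 : ℝ) ≤ 1 / n := by positivity
      have h3 := Finset.sum_le_sum fun i (_ : i ∈ (Finset.univ : Finset (Fin n))) =>
        hd (o i).1 (est (C (d2 fun i => (o i).2.2) i) (o i).2.2)
      simp only [Finset.sum_const, Finset.card_univ, Fintype.card_fin, nsmul_eq_mul,
        mul_one] at h3
      have h4 : 0 ≤ (1 / (n : ℝ)) * ∑ i, ch.dist (o i).1 (est (C w i) (o i).2.2) :=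
        mul_nonneg hn (Finset.sum_nonneg fun i _ => ch.dist_nonneg _ _)
      have h5 : (1 / (n : ℝ)) * ∑ i, ch.dist (o i).1
          (est (C (d2 fun i => (o i).2.2) i) (o i).2.2) ≤ 1 := by
        rw [one_div, ← div_eq_inv_mul]
        exact div_le_one_of_le₀ h3 (by positivity)
      linarith
  have := mul_le_mul_of_nonneg_left
    (add_le_add (mul_le_mul_of_nonneg_left herr hα) hdist) hp
  -- Distortion needs only the extra `c2`; the surplus `c1` makes the bound symmetric in the two
  -- receivers.
  have h6 := mul_nonneg hp hc1
  nlinarith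

open Classical in
-- Error and distortion are combined into one functional before averaging over codebooks, so a
-- single codebook that is no worse than average serves for both.
theorem exists_code_le_of_typical [Fintype X] [DecidableEq S] [DecidableEq Y] [DecidableEq Z]
    (ch : SDMBC X S Y Z) {P : X → ℝ}
    (hP0 : ∀ x, 0 ≤ P x)
    (hP1 : ∑ x, P x = 1) (est : X → Z → S) (hd : ∀ s s', ch.dist s s' ≤ 1) {K : ℝ} (hK : 0 < K)
    {M n : ℕ} (hM : 0 < M) (hn : 0 < n) {α δ1 δ2 : ℝ} (hα : 0 ≤ α)
    (h1 : ∑ x : Fin n → X, iidLaw P x *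
      ∑ b, wordLaw ch.commLaw x b * (if Typical P ch.commLaw K x b then 0 else 1) ≤ δ1)
    (h2 : ∑ x : Fin n → X, iidLaw P x *
      ∑ b, wordLaw ch.senseLaw x b * (if Typical P ch.senseLaw K x b then 0 else 1) ≤ δ2) :
    ∃ c : DMSCode X S Y Z M 1 n, α * ch.errorProb c + ch.distortion c ≤
      (α + 1) * (δ1 + δ2 + 2 * (M * (K ^ n)⁻¹)) + ∑ x, P x * ch.letterDist est x := by
  have hM' : (0 : ℝ) < M := by exact_mod_cast hM
  have hn' : (0 : ℝ) < n := by exact_mod_cast hn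
  have hs : ∑ x : Fin n → X, iidLaw P x = 1 := sum_iidLaw hP1
  obtain ⟨C, hC⟩ := exists_le_weighted_sum (codebookLaw P (M := M) (n := n))
    (fun C => Finset.prod_nonneg fun w _ => iidLaw_nonneg hP0 _)
    (sum_prod_eq_one (fun _ => iidLaw P) fun _ => hs)
    (fun C => (1 / M) * ∑ w, ((α + 1) *
        ((∑ b, wordLaw ch.commLaw (C w) b *
            confusion (fun v => Typical P ch.commLaw K (C v) b) w)
          + ∑ b, wordLaw ch.senseLaw (C w) b *
            confusion (fun v => Typical P ch.senseLaw K (C v) b) w)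
        + (1 / (n : ℝ)) * ∑ i, ch.letterDist est (C w i)))
  obtain ⟨c, hc⟩ := ch.exists_code_le est hd hM C
    (fun v b => Typical P ch.commLaw K (C v) b) (fun v b => Typical P ch.senseLaw K (C v) b) hα
  refine ⟨c, hc.trans (hC.trans ?_)⟩
  have hw : ∀ w : Fin M, ∑ C : Fin M → Fin n → X, codebookLaw P C * ((α + 1) *
        ((∑ b, wordLaw ch.commLaw (C w) b *
            confusion (fun v => Typical P ch.commLaw K (C v) b) w)
          + ∑ b, wordLaw ch.senseLaw (C w) b *
            confusion (fun v => Typical P ch.senseLaw K (C v) b) w)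
        + (1 / (n : ℝ)) * ∑ i, ch.letterDist est (C w i))
      ≤ (α + 1) * (δ1 + δ2 + 2 * (M * (K ^ n)⁻¹)) + ∑ x, P x * ch.letterDist est x := by
    intro w
    have e1 := sum_codebookLaw_mul_confusion_le hP0 hP1 ch.isChannel_commLaw hK w h1
    have e2 := sum_codebookLaw_mul_confusion_le hP0 hP1 ch.isChannel_senseLaw hK w h2
    have e3 : ∑ C : Fin M → Fin n → X, codebookLaw P C *
        ((1 / (n : ℝ)) * ∑ i, ch.letterDist est (C w i)) = ∑ x, P x * ch.letterDist est x := by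
      refine (sum_prod_mul_apply (fun _ : Fin M => iidLaw P (n := n)) (fun _ => hs) w
        (fun x => (1 / (n : ℝ)) * ∑ i, ch.letterDist est (x i))).trans ?_
      have e4 : ∀ i, ∑ x : Fin n → X, iidLaw P x * ch.letterDist est (x i)
          = ∑ x, P x * ch.letterDist est x := fun i =>
        sum_prod_mul_apply (fun _ => P) (fun _ => hP1) i (ch.letterDist est)
      simp_rw [Finset.mul_sum]
      rw [Finset.sum_comm]
      simp_rw [mul_left_comm _ (1 / (n : ℝ)), ← Finset.mul_sum, e4]
      simp only [Finset.sum_const, Finset.card_univ, Fintype.card_fin, nsmul_eq_mul]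
      field_simp
    simp only [mul_add (codebookLaw P _), mul_left_comm (codebookLaw P _) (α + 1),
      Finset.sum_add_distrib, ← Finset.mul_sum]
    simp only [Finset.mul_sum] at e3 ⊢
    simp only [← Finset.mul_sum] at e3 ⊢
    rw [e3]
    have := mul_le_mul_of_nonneg_left (add_le_add e1 e2) (by linarith : 0 ≤ α + 1)
    linarith
  have := Finset.sum_le_sum fun w (_ : w ∈ Finset.univ) => hw w
  rw [Finset.sum_comm] at this
  simp only [Finset.sum_const, Finset.card_univ, Fintype.card_fin, nsmul_eq_mul,
    ← Finset.mul_sum] at this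
  simp_rw [mul_left_comm _ (1 / (M : ℝ))]
  rw [← Finset.mul_sum, one_div, ← div_eq_inv_mul, div_le_iff₀ hM', mul_comm _ (M : ℝ)]
  exact this

/-- The weight on the error is taken to be the block length n. The remainder (n + 1) η n still
vanishes, because η decays exponentially. So the error is of order 1/n, and the distortion is at
most its target plus a vanishing term. -/
theorem achievable_of_lt_infoNats [Fintype X] [DecidableEq S] [DecidableEq Y] [DecidableEq Z]
    (ch : SDMBC X S Y Z) {P : X → ℝ} (hP0 : ∀ x, 0 ≤ P x) (hP1 : ∑ x, P x = 1)
    (est : X → Z → S) (hd : ∀ s s', ch.dist s s' ≤ 1) {R D : ℝ} (hR : 0 ≤ R)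
    (hR1 : R * Real.log 2 < infoNats P ch.commLaw)
    (hR2 : R * Real.log 2 < infoNats P ch.senseLaw)
    (hD : ∑ x, P x * ch.letterDist est x < D) : ch.Achievable R 0 D := by
  classical
  -- The threshold exp κ lies strictly between the rate and both informations, which makes missed
  -- detections and false alarms both exponentially rare.
  obtain ⟨κ, hκ, hκI⟩ := exists_between (lt_min hR1 hR2)
  obtain ⟨hκ1, hκ2⟩ := lt_min_iff.1 hκI
  rw [← Real.log_exp κ] at hκ1 hκ2
  obtain ⟨θ1, h10, h11, ht1⟩ := exists_atypical_le hP0 hP1 ch.isChannel_commLaw hκ1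
  obtain ⟨θ2, h20, h21, ht2⟩ := exists_atypical_le hP0 hP1 ch.isChannel_senseLaw hκ2
  set ρ := Real.exp (R * Real.log 2 - κ) with hρ
  have hρ1 : ρ < 1 := Real.exp_lt_one_iff.2 (by linarith)
  set Dg := ∑ x, P x * ch.letterDist est x with hDg
  -- The 4 is 2 receivers times the rounding factor 2 of `msgCount_le`.
  set η : ℕ → ℝ := fun n => θ1 ^ n + θ2 ^ n + 4 * ρ ^ n with hη
  have hcode : ∀ n : ℕ, ∃ c : DMSCode X S Y Z (msgCount R n) (msgCount 0 n) n,
      0 < n → n * ch.errorProb c + ch.distortion c ≤ (n + 1) * η n + Dg := by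
    intro n
    rw [msgCount_zero]
    rcases Nat.eq_zero_or_pos n with rfl | hn
    -- At block length 0 any code will do, since the bound is required only for n > 0.
    · exact ⟨⟨fun _ _ i => i.elim0, fun _ _ => (⟨0, msgCount_pos R 0⟩, 0),
        fun _ => ⟨0, msgCount_pos R 0⟩, fun _ i => i.elim0⟩, fun h => absurd h (lt_irrefl 0)⟩
    · obtain ⟨c, hc⟩ := ch.exists_code_le_of_typical hP0 hP1 est hd (Real.exp_pos κ)
        (msgCount_pos R n) hn (Nat.cast_nonneg n) (ht1 n) (ht2 n)
      refine ⟨c, fun _ => hc.trans ?_⟩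
      have hM : (msgCount R n : ℝ) * (Real.exp κ ^ n)⁻¹ ≤ 2 * ρ ^ n := by
        have h := msgCount_le hR n
        have e : ρ ^ n = Real.exp (n * (R * Real.log 2)) * (Real.exp κ ^ n)⁻¹ := by
          rw [hρ, ← Real.exp_nat_mul, ← Real.exp_nat_mul, ← Real.exp_neg, ← Real.exp_add]
          ring_nf
        rw [e, ← mul_assoc]
        exact mul_le_mul_of_nonneg_right h (by positivity)
      have : θ1 ^ n + θ2 ^ n + 2 * (msgCount R n * (Real.exp κ ^ n)⁻¹) ≤ η n := by
        simp only [hη]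
        linarith
      have := mul_le_mul_of_nonneg_left this (by positivity : (0 : ℝ) ≤ n + 1)
      linarith
  choose c hc using hcode
  have hgeom : ∀ r : ℝ, 0 ≤ r → r < 1 → Tendsto (fun n : ℕ => ((n : ℝ) + 1) * r ^ n) atTop (𝓝 0) := by
    intro r h0 h1
    have := (tendsto_self_mul_const_pow_of_lt_one h0 h1).add
      (tendsto_pow_atTop_nhds_zero_of_lt_one h0 h1)
    simpa [add_mul] using this
  have hηt : Tendsto (fun n : ℕ => ((n : ℝ) + 1) * η n) atTop (𝓝 0) := by
    have := ((hgeom θ1 h10 h11).add (hgeom θ2 h20 h21)).add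
      ((hgeom ρ (Real.exp_pos _).le hρ1).const_mul 4)
    simp only [add_zero, mul_zero] at this
    refine this.congr fun n => ?_
    simp only [hη]
    ring
  have hbt : Tendsto (fun n : ℕ => ((n : ℝ) + 1) * η n + Dg) atTop (𝓝 Dg) := by
    simpa using hηt.add_const Dg
  refine ⟨hR, le_rfl, c, ?_, ?_⟩
  · have hdiv : Tendsto (fun n : ℕ => (((n : ℝ) + 1) * η n + Dg) / n) atTop (𝓝 0) :=
      hbt.div_atTop tendsto_natCast_atTop_atTop
    refine squeeze_zero' (Eventually.of_forall fun n => ch.errorProb_nonneg (c n)) ?_ hdiv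
    filter_upwards [eventually_gt_atTop 0] with n hn
    rw [le_div_iff₀ (by exact_mod_cast hn)]
    have := hc n hn
    have := ch.distortion_nonneg (c n)
    linarith
  · refine limsup_le_of_le ?_ ?_
    · exact (isBoundedUnder_of ⟨0, fun n => ch.distortion_nonneg (c n)⟩ :
        IsBoundedUnder (· ≥ ·) atTop fun n => ch.distortion (c n)).isCoboundedUnder_le
    · filter_upwards [eventually_gt_atTop 0, hbt.eventually_le_const hD] with n hn hle
      have := hc n hn
      have := mul_nonneg (Nat.cast_nonneg (α := ℝ) n) (ch.errorProb_nonneg (c n))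
      linarith

end Achievability

end SDMBC

/-! ### Geometry of the region below a strictly concave curve. -/

section TradeoffCurve

variable {f : ℝ → ℝ}

theorem StrictConcaveOn.pos_of_endpoints (hsc : StrictConcaveOn ℝ (Set.Icc 0 1) f)
    (h0 : f 0 = 0) (h1 : f 1 = 0) {p : ℝ} (hp : p ∈ Set.Ioo (0 : ℝ) 1) : 0 < f p := by
  have := hsc.2 (Set.left_mem_Icc.2 zero_le_one) (Set.right_mem_Icc.2 zero_le_one) zero_ne_one
    (sub_pos.2 hp.2) hp.1 (sub_add_cancel 1 p)
  simpa [h0, h1] using this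

theorem StrictConcaveOn.existsUnique_isMaxOn_Icc (hsc : StrictConcaveOn ℝ (Set.Icc 0 1) f)
    (hc : ContinuousOn f (Set.Icc 0 1)) :
    ∃! pmax, pmax ∈ Set.Icc (0 : ℝ) 1 ∧ IsMaxOn f (Set.Icc (0 : ℝ) 1) pmax := by
  obtain ⟨p, hp, hmax⟩ := isCompact_Icc.exists_isMaxOn
    (Set.nonempty_Icc.2 (zero_le_one' ℝ)) hc
  exact ⟨p, ⟨hp, hmax⟩, fun p' hp' => hsc.eq_of_isMaxOn hp'.2 hmax hp'.1 hp⟩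

theorem ConcaveOn.le_of_le_isMaxOn (hsc : ConcaveOn ℝ (Set.Icc 0 1) f) {pmax : ℝ}
    (hp : pmax ∈ Set.Icc (0 : ℝ) 1) (hmax : IsMaxOn f (Set.Icc (0 : ℝ) 1) pmax) {x y : ℝ}
    (hx : 0 ≤ x) (hxy : x ≤ y) (hy : y ≤ pmax) : f x ≤ f y := by
  have hx1 : x ∈ Set.Icc (0 : ℝ) 1 := ⟨hx, hxy.trans (hy.trans hp.2)⟩
  have := hsc.min_le_of_mem_Icc hx1 hp ⟨hxy, hy⟩
  rwa [min_eq_left (hmax hx1)] at this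

/-- The region below the curve `p ↦ (f p, p m)`, `p ∈ [0, pmax]`. -/
def regionBelow (f : ℝ → ℝ) (m pmax : ℝ) : Set (ℝ × ℝ) :=
  {t | ∃ p ∈ Set.Icc (0 : ℝ) pmax, 0 ≤ t.1 ∧ t.1 ≤ f p ∧ p * m ≤ t.2}

/-- Since f is nondecreasing up to its maximizer, the best p for a given D is D / m clamped to [0,
pmax]. The clamp is continuous in D, so the existential over p becomes finitely many closed
conditions. -/
theorem isClosed_regionBelow (hc : ContinuousOn f (Set.Icc 0 1))
    (hsc : ConcaveOn ℝ (Set.Icc 0 1) f) {m pmax : ℝ} (hm : 0 < m)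
    (hp : pmax ∈ Set.Icc (0 : ℝ) 1) (hmax : IsMaxOn f (Set.Icc (0 : ℝ) 1) pmax) :
    IsClosed (regionBelow f m pmax) := by
  set u : ℝ × ℝ → ℝ := fun t => max 0 (min pmax (t.2 / m)) with hu
  have hu0 : ∀ t, 0 ≤ u t := fun t => le_max_left _ _
  have hup : ∀ t, u t ≤ pmax := fun t => max_le hp.1 (min_le_left _ _)
  have huc : Continuous u := by fun_prop
  have hfu : Continuous fun t => f (u t) :=
    hc.comp_continuous huc fun t => ⟨hu0 t, (hup t).trans hp.2⟩
  have : regionBelow f m pmax = {t | 0 ≤ t.1} ∩ {t | 0 ≤ t.2} ∩ {t | t.1 ≤ f (u t)} := by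
    ext t
    constructor
    · rintro ⟨p, hpm, h0, h1, h2⟩
      refine ⟨⟨h0, (mul_nonneg hpm.1 hm.le).trans h2⟩, h1.trans ?_⟩
      refine hsc.le_of_le_isMaxOn hp hmax hpm.1 ?_ (hup t)
      exact le_max_of_le_right (le_min hpm.2 ((le_div_iff₀ hm).2 h2))
    · rintro ⟨⟨h0, h2⟩, h1⟩
      refine ⟨u t, ⟨hu0 t, hup t⟩, h0, h1, ?_⟩
      rw [← le_div_iff₀ hm]
      exact max_le (div_nonneg h2 hm.le) (min_le_right _ _)
  rw [this]
  exact ((isClosed_le continuous_const continuous_fst).inter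
    (isClosed_le continuous_const continuous_snd)).inter (isClosed_le continuous_fst hfu)

/-- A parameter beyond `pmax` may be replaced by `pmax`, which raises the rate bound and lowers the
distortion. Conversely, each point of the region is a limit of points ((1 - ε) R, D + ε) that
satisfy the strict inequalities of `hach`. -/
theorem closure_eq_regionBelow (hc : ContinuousOn f (Set.Icc 0 1))
    (hsc : StrictConcaveOn ℝ (Set.Icc 0 1) f) (h0 : f 0 = 0) (h1 : f 1 = 0)
    {A : Set (ℝ × ℝ)} {m pmax : ℝ} (hm : 0 < m)
    (hconv : ∀ t ∈ A, 0 ≤ t.1 ∧ ∃ p ∈ Set.Icc (0 : ℝ) 1, t.1 ≤ f p ∧ p * m ≤ t.2)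
    (hach : ∀ p ∈ Set.Ioo (0 : ℝ) 1, ∀ R D, 0 ≤ R → R < f p → p * m < D → (R, D) ∈ A)
    (hp : pmax ∈ Set.Icc (0 : ℝ) 1) (hmax : IsMaxOn f (Set.Icc (0 : ℝ) 1) pmax) :
    closure A = regionBelow f m pmax := by
  have hpmax1 : pmax < 1 := by
    refine lt_of_le_of_ne hp.2 fun h => ?_
    have hhalf := hsc.pos_of_endpoints h0 h1 (p := 1 / 2) (by norm_num)
    have : f (1 / 2) ≤ f pmax := hmax (show (1 / 2 : ℝ) ∈ Set.Icc (0 : ℝ) 1 by norm_num)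
    rw [h, h1] at this
    linarith
  refine Set.Subset.antisymm
    (closure_minimal ?_ (isClosed_regionBelow hc hsc.concaveOn hm hp hmax)) ?_
  · intro t ht
    obtain ⟨ht0, p, hp01, hR, hD⟩ := hconv t ht
    rcases le_total p pmax with h | h
    · exact ⟨p, ⟨hp01.1, h⟩, ht0, hR, hD⟩
    · exact ⟨pmax, ⟨hp.1, le_rfl⟩, ht0, hR.trans (hmax hp01),
        (mul_le_mul_of_nonneg_right h hm.le).trans hD⟩
  · rintro ⟨R, D⟩ ⟨p, hpm, hR0, hR, hD⟩
    dsimp only at hR0 hR hD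
    have hlim : Tendsto (fun ε : ℝ => ((1 - ε) * R, D + ε)) (𝓝[>] 0) (𝓝 (R, D)) := by
      have : Continuous fun ε : ℝ => ((1 - ε) * R, D + ε) := by fun_prop
      have := this.tendsto 0
      simp only [sub_zero, one_mul, add_zero] at this
      exact this.mono_left nhdsWithin_le_nhds
    refine mem_closure_of_tendsto hlim ?_
    filter_upwards [Ioo_mem_nhdsGT (zero_lt_one' ℝ)] with ε hε
    have hR1 : 0 ≤ (1 - ε) * R := mul_nonneg (sub_nonneg.2 hε.2.le) hR0
    rcases hpm.1.eq_or_lt with rfl | hp0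
    -- At p = 0 the rate is 0 and `hach` does not apply directly; a small positive parameter is used
    -- instead, costing at most ε / 2 in distortion.
    · rw [h0] at hR
      obtain rfl : R = 0 := le_antisymm hR hR0
      have hε0 : 0 < ε / (2 * m) := div_pos hε.1 (by linarith)
      have hp' : min (1 / 2) (ε / (2 * m)) ∈ Set.Ioo (0 : ℝ) 1 :=
        ⟨lt_min (by norm_num) hε0, lt_of_le_of_lt (min_le_left _ _) (by norm_num)⟩
      refine hach _ hp' _ _ hR1 (by simpa using hsc.pos_of_endpoints h0 h1 hp') ?_
      have h1 : min (1 / 2) (ε / (2 * m)) * m ≤ ε / (2 * m) * m :=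
        mul_le_mul_of_nonneg_right (min_le_right _ _) hm.le
      have h2 : ε / (2 * m) * m = ε / 2 := by field_simp
      have := hε.1
      linarith
    · have hp' : p ∈ Set.Ioo (0 : ℝ) 1 := ⟨hp0, hpm.2.trans_lt hpmax1⟩
      refine hach p hp' _ _ hR1 ?_ (by linarith [hε.1])
      have h3 := mul_le_mul_of_nonneg_left hR (sub_nonneg.2 hε.2.le)
      have h4 := mul_pos hε.1 (hsc.pos_of_endpoints h0 h1 hp')
      linarith

theorem isGreatest_regionBelow (hsc : ConcaveOn ℝ (Set.Icc 0 1) f) (h0 : f 0 = 0)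
    {m pmax : ℝ} (hm : 0 < m)
    (hp : pmax ∈ Set.Icc (0 : ℝ) 1) (hmax : IsMaxOn f (Set.Icc (0 : ℝ) 1) pmax) {p : ℝ}
    (hpm : p ∈ Set.Icc (0 : ℝ) pmax) :
    IsGreatest {R | (R, p * m) ∈ regionBelow f m pmax} (f p) := by
  refine ⟨⟨p, hpm, ?_, le_rfl, le_rfl⟩, ?_⟩
  · rw [← h0]
    exact hsc.le_of_le_isMaxOn hp hmax le_rfl hpm.1 hpm.2
  · rintro R ⟨p', hp', -, hR, hD⟩
    exact hR.trans (hsc.le_of_le_isMaxOn hp hmax hp'.1 (le_of_mul_le_mul_right hD hm) hpm.2)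

theorem isGreatest_regionBelow_of_le (hsc : ConcaveOn ℝ (Set.Icc 0 1) f) (h0 : f 0 = 0)
    {m pmax : ℝ} (hp : pmax ∈ Set.Icc (0 : ℝ) 1) (hmax : IsMaxOn f (Set.Icc (0 : ℝ) 1) pmax)
    {D : ℝ} (hD : pmax * m ≤ D) :
    IsGreatest {R | (R, D) ∈ regionBelow f m pmax} (f pmax) := by
  refine ⟨⟨pmax, ⟨hp.1, le_rfl⟩, ?_, le_rfl, hD⟩, ?_⟩
  · rw [← h0]
    exact hsc.le_of_le_isMaxOn hp hmax le_rfl hp.1 le_rfl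
  · rintro R ⟨p', hp', -, hR, -⟩
    exact hR.trans (hsc.le_of_le_isMaxOn hp hmax hp'.1 hp'.2 le_rfl)

end TradeoffCurve

/-! ### Mutual information through entropies, and the change of units. -/

section MutualInformation

variable {A B : Type} [Fintype A] [Fintype B]

/-- Mutual information as output entropy minus conditional output entropy. -/
theorem infoNats_eq_entropy_sub {P : A → ℝ} {W : A → B → ℝ} (hP : ∀ a, 0 ≤ P a)
    (hW : IsChannel W) :
    infoNats P W = ∑ b, Real.negMulLog (outLaw P W b)
      - ∑ a, P a * ∑ b, Real.negMulLog (W a b) := by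
  have h1 : ∑ b, Real.negMulLog (outLaw P W b)
      = ∑ a, ∑ b, -(P a * W a b * Real.log (outLaw P W b)) := by
    rw [Finset.sum_comm]
    refine Finset.sum_congr rfl fun b _ => ?_
    rw [Finset.sum_neg_distrib, ← Finset.sum_mul, Real.negMulLog, ← outLaw, neg_mul]
  rw [h1, infoNats, ← Finset.sum_sub_distrib]
  refine Finset.sum_congr rfl fun a _ => ?_
  rw [Finset.mul_sum, Finset.mul_sum, ← Finset.sum_sub_distrib]
  refine Finset.sum_congr rfl fun b _ => ?_
  rcases (hP a).eq_or_lt with ha | ha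
  · simp [← ha]
  by_cases hb : W a b = 0
  · simp [hb]
  · rw [Real.log_div hb (outLaw_pos hP hW ha hb).ne', Real.negMulLog]
    ring

theorem mutualInfoBits_eq {P : A → ℝ} {W : A → B → ℝ} (hW : IsChannel W) :
    mutualInfoBits (fun a b => P a * W a b) = infoNats P W / Real.log 2 := by
  unfold mutualInfoBits infoNats
  rw [Finset.sum_div]
  refine Finset.sum_congr rfl fun a _ => ?_
  rw [← Finset.mul_sum, hW.sum, mul_one, Finset.mul_sum, Finset.sum_div]
  refine Finset.sum_congr rfl fun b _ => ?_
  by_cases ha : P a = 0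
  · simp [ha]
  · change P a * W a b * Real.logb 2 (P a * W a b / (P a * outLaw P W b)) = _
    rw [mul_div_mul_left _ _ ha, Real.logb]
    ring

end MutualInformation

theorem SDMBC.jointXZ_eq {X S Y Z : Type} [Fintype S] [Fintype Y] [Fintype Z] [DecidableEq Z]
    (ch : SDMBC X S Y Z) (P : X → ℝ) :
    ch.jointXZ P = fun x z => P x * ch.senseLaw x z := by
  funext x z
  simp only [jointXZ, senseLaw, pushLaw, fullLaw, Fintype.sum_prod_type, Finset.mul_sum]
  simp [mul_assoc]

theorem H2_eq_binEntropy_div (p : ℝ) : H2 p = Real.binEntropy p / Real.log 2 := by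
  rw [Real.binEntropy_eq_negMulLog_add_negMulLog_one_sub, H2, Real.negMulLog, Real.negMulLog,
    Real.logb, Real.logb]
  ring

/-! ### The binary example: alphabet, information quantities and estimator. -/

section SenseAlphabet

variable {a : ℝ}

/-- The letters `0, 1, a, a + 1`. -/
noncomputable def senseLetter (a : ℝ) (i : Fin 4) : SenseAlphabet a :=
  ⟨![0, 1, a, a + 1] i, by fin_cases i <;> simp⟩

/-- The condition 0 < a < 1 keeps the four letters distinct, so sums over the alphabet become sums
over four indices. -/
theorem senseLetter_bijective (ha : a ∈ Set.Ioo (0 : ℝ) 1) :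
    Function.Bijective (senseLetter a) := by
  obtain ⟨h0, h1⟩ := ha
  constructor
  · intro i j hij
    have h := congrArg Subtype.val hij
    fin_cases i <;> fin_cases j <;> simp [senseLetter] at h ⊢ <;> linarith
  · rintro ⟨z, hz⟩
    simp only [Finset.mem_insert, Finset.mem_singleton] at hz
    rcases hz with rfl | rfl | rfl | rfl
    · exact ⟨0, rfl⟩
    · exact ⟨1, rfl⟩
    · exact ⟨2, rfl⟩
    · exact ⟨3, rfl⟩

theorem sum_senseAlphabet (ha : a ∈ Set.Ioo (0 : ℝ) 1) (F : SenseAlphabet a → ℝ) :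
    ∑ z, F z = ∑ i, F (senseLetter a i) :=
  (Fintype.sum_bijective _ (senseLetter_bijective ha) _ _ fun _ => rfl).symm

end SenseAlphabet

section Example

variable {q e a : ℝ} (hq : q ∈ Set.Ioo (0 : ℝ) 1) (he : e ∈ Set.Icc (0 : ℝ) 1)

theorem senseLaw_example (ha : a ∈ Set.Ioo (0 : ℝ) 1) (x : Fin 2) (i : Fin 4) :
    (exampleChannel q e a hq he).senseLaw x (senseLetter a i)
      = (![![1 - e, e, 0, 0], ![(1 - q) * e, (1 - q) * (1 - e), q * e, q * (1 - e)]] :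
          Fin 2 → Fin 4 → ℝ) x i := by
  obtain ⟨h0, h1⟩ := ha
  have n1 : a ≠ 0 := h0.ne'
  have n2 : a ≠ 1 := h1.ne
  have n3 : a + 1 ≠ 0 := by linarith
  have n4 : (0 : ℝ) ≠ a + 1 := by linarith
  have n5 : (1 : ℝ) ≠ a + 1 := by linarith
  have h : (exampleChannel q e a hq he).senseLaw x (senseLetter a i)
      = ∑ s, ∑ n, bern q s * (bern e n *
        if (![0, 1, a, a + 1] : Fin 4 → ℝ) i = senseValue a x s n then 1 else 0) := by
    simp only [SDMBC.senseLaw, pushLaw, SDMBC.fullLaw, Fintype.sum_prod_type, exampleChannel,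
      exampleTrans, Finset.sum_ite_eq', Finset.mem_univ, if_true]
    refine Finset.sum_congr rfl fun s _ => ?_
    simp_rw [Finset.mul_sum]
    rw [Finset.sum_comm]
    refine Finset.sum_congr rfl fun n _ => ?_
    rw [Finset.sum_eq_single (s * x)]
    · simp [senseLetter]
    · intro y _ hy
      simp [hy]
    · simp
  rw [h]
  simp only [Fin.sum_univ_two]
  fin_cases x <;> fin_cases i <;>
    simp [bern, senseValue, n1, n2, n3, n1.symm, n2.symm, n4, n5] <;> ring

theorem commLaw_example (x y s : Fin 2) :
    (exampleChannel q e a hq he).commLaw x (y, s) = if y = s * x then bern q s else 0 := by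
  have h : ∑ z, exampleTrans e a x s y z = if y = s * x then 1 else 0 := by
    have h1 : ∀ y', 0 ≤ ∑ z, exampleTrans e a x s y' z := fun y' =>
      Finset.sum_nonneg fun z _ => (exampleChannel q e a hq he).trans_nonneg x s y' z
    have h2 : ∀ y', y' ≠ s * x → ∑ z, exampleTrans e a x s y' z = 0 := by
      intro y' hy'
      simp [exampleTrans, hy']
    have h3 := exampleTrans_sum e a x s
    rw [Finset.sum_eq_single (s * x) (fun y' _ hy' => h2 y' hy') (by simp)] at h3
    split_ifs with hy
    · rw [hy, h3]
    · exact h2 y hy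
  have h' : (exampleChannel q e a hq he).commLaw x (y, s)
      = bern q s * ∑ z, exampleTrans e a x s y z := by
    simp only [SDMBC.commLaw, pushLaw, SDMBC.fullLaw, Fintype.sum_prod_type, Prod.mk.injEq,
      Finset.mul_sum]
    rw [Finset.sum_eq_single s, Finset.sum_eq_single y]
    · simp [exampleChannel]
    · intro y' _ hy'
      simp [hy']
    · simp
    · intro s' _ hs'
      simp [hs']
    · simp
  rw [h', h]
  simp

/-- The mutual information `I(X; Z)` of the example in nats. -/
noncomputable def senseInfo (q e p : ℝ) : ℝ :=
  Real.negMulLog (p * (1 - e) + (1 - p) * ((1 - q) * e))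
    + Real.negMulLog (p * e + (1 - p) * ((1 - q) * (1 - e)))
    + Real.negMulLog ((1 - p) * (q * e)) + Real.negMulLog ((1 - p) * (q * (1 - e)))
    - p * (Real.negMulLog (1 - e) + Real.negMulLog e)
    - (1 - p) * (Real.negMulLog ((1 - q) * e) + Real.negMulLog ((1 - q) * (1 - e))
      + Real.negMulLog (q * e) + Real.negMulLog (q * (1 - e)))

theorem bern_one_sub_nonneg {p : ℝ} (hp : p ∈ Set.Icc (0 : ℝ) 1) (x : Fin 2) :
    0 ≤ bern (1 - p) x :=
  bern_nonneg (sub_nonneg.2 hp.2) (sub_le_self 1 hp.1) x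

theorem infoNats_senseLaw_example (ha : a ∈ Set.Ioo (0 : ℝ) 1) {p : ℝ}
    (hp : p ∈ Set.Icc (0 : ℝ) 1) :
    infoNats (bern (1 - p)) (exampleChannel q e a hq he).senseLaw = senseInfo q e p := by
  rw [infoNats_eq_entropy_sub (bern_one_sub_nonneg hp)
    (exampleChannel q e a hq he).isChannel_senseLaw, sum_senseAlphabet ha]
  simp only [outLaw, sum_senseAlphabet ha, senseLaw_example hq he ha]
  simp [Fin.sum_univ_four, Fin.sum_univ_two, bern, senseInfo]
  ring

/-- A receiver that knows the state sees X when S = 1 and nothing when S = 0: an erasure channel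
with erasure probability 1 - q. -/
theorem infoNats_commLaw_example {p : ℝ}
    (hp : p ∈ Set.Icc (0 : ℝ) 1) :
    infoNats (bern (1 - p)) (exampleChannel q e a hq he).commLaw = q * Real.binEntropy p := by
  rw [infoNats_eq_entropy_sub (bern_one_sub_nonneg hp)
    (exampleChannel q e a hq he).isChannel_commLaw]
  simp only [outLaw, Fintype.sum_prod_type, commLaw_example hq he]
  simp [Fin.sum_univ_two, bern, Real.binEntropy_eq_negMulLog_add_negMulLog_one_sub,
    Real.negMulLog_mul]
  have : Real.negMulLog (p * (1 - q) + (1 - p) * (1 - q)) = Real.negMulLog (1 - q) := by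
    ring_nf
  rw [this]
  ring

theorem exampleIXZ_eq (ha : a ∈ Set.Ioo (0 : ℝ) 1) {p : ℝ} (hp : p ∈ Set.Icc (0 : ℝ) 1) :
    exampleIXZ q e a hq he p = senseInfo q e p / Real.log 2 := by
  rw [exampleIXZ, SDMBC.jointXZ_eq,
    mutualInfoBits_eq (exampleChannel q e a hq he).isChannel_senseLaw,
    infoNats_senseLaw_example hq he ha hp]

theorem exampleRate_eq (ha : a ∈ Set.Ioo (0 : ℝ) 1) {p : ℝ} (hp : p ∈ Set.Icc (0 : ℝ) 1) :
    exampleRate q e a hq he p = min (q * Real.binEntropy p) (senseInfo q e p) / Real.log 2 := by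
  rw [exampleRate, exampleIXZ_eq hq he ha hp, H2_eq_binEntropy_div, mul_div_assoc',
    min_div_div_right (Real.log_pos one_lt_two).le]

theorem exampleRate_mul_log_two (ha : a ∈ Set.Ioo (0 : ℝ) 1) {p : ℝ}
    (hp : p ∈ Set.Icc (0 : ℝ) 1) :
    exampleRate q e a hq he p * Real.log 2
      = min (infoNats (bern (1 - p)) (exampleChannel q e a hq he).commLaw)
        (infoNats (bern (1 - p)) (exampleChannel q e a hq he).senseLaw) := by
  rw [exampleRate_eq hq he ha hp, infoNats_commLaw_example hq he hp,
    infoNats_senseLaw_example hq he ha hp, div_mul_cancel₀ _ (Real.log_pos one_lt_two).ne']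

theorem concaveOn_negMulLog_affine {u v : ℝ} (hu : 0 ≤ u) (hv : 0 ≤ v) :
    ConcaveOn ℝ (Set.Icc 0 1) fun p => Real.negMulLog (p * u + (1 - p) * v) := by
  refine ⟨convex_Icc 0 1, fun x hx y hy s t hs ht hst => ?_⟩
  have hpos : ∀ z ∈ Set.Icc (0 : ℝ) 1, z * u + (1 - z) * v ∈ Set.Ici (0 : ℝ) := fun z hz =>
    add_nonneg (mul_nonneg hz.1 hu) (mul_nonneg (sub_nonneg.2 hz.2) hv)
  have h := Real.concaveOn_negMulLog.2 (hpos x hx) (hpos y hy) hs ht hst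
  refine h.trans (le_of_eq ?_)
  congr 1
  obtain rfl : t = 1 - s := by linarith
  simp only [smul_eq_mul]
  ring

theorem strictConcaveOn_negMulLog_one_sub :
    StrictConcaveOn ℝ (Set.Icc 0 1) fun p : ℝ => Real.negMulLog (1 - p) := by
  refine ⟨convex_Icc 0 1, fun x hx y hy hxy s t hs ht hst => ?_⟩
  have h := Real.strictConcaveOn_negMulLog.2 (sub_nonneg.2 hx.2 : 1 - x ∈ Set.Ici (0 : ℝ))
    (sub_nonneg.2 hy.2 : 1 - y ∈ Set.Ici (0 : ℝ)) (fun h => hxy (by linarith)) hs ht hst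
  refine h.trans_eq ?_
  congr 1
  obtain rfl : t = 1 - s := by linarith
  simp only [smul_eq_mul]
  ring

theorem StrictConcaveOn.const_mul {f : ℝ → ℝ} {s : Set ℝ} (hf : StrictConcaveOn ℝ s f) {c : ℝ}
    (hc : 0 < c) : StrictConcaveOn ℝ s fun p => c * f p := by
  refine ⟨hf.1, fun x hx y hy hxy α β hα hβ h => ?_⟩
  have := mul_lt_mul_of_pos_left (hf.2 hx hy hxy hα hβ h) hc
  simp only [smul_eq_mul] at this ⊢
  linarith

theorem concaveOn_affine (u v : ℝ) : ConcaveOn ℝ (Set.Icc 0 1) fun p : ℝ => u * p + v := by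
  refine ⟨convex_Icc 0 1, fun x _ y _ s t _ _ hst => le_of_eq ?_⟩
  obtain rfl : t = 1 - s := by linarith
  simp only [smul_eq_mul]
  ring

/-- The letters a and a + 1 occur only under input 1, with masses (1 - p) q e and (1 - p) q (1 - e).
Their entropy terms split into q `negMulLog` (1 - p) plus affine terms that cancel against the
conditional entropy. This summand is strictly concave for every e; the other terms are concave or
affine. -/
theorem strictConcaveOn_senseInfo (hq : q ∈ Set.Ioo (0 : ℝ) 1) (he : e ∈ Set.Icc (0 : ℝ) 1) :
    StrictConcaveOn ℝ (Set.Icc 0 1) (senseInfo q e) := by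
  have hq' : 0 ≤ 1 - q := sub_nonneg.2 hq.2.le
  have he' : 0 ≤ 1 - e := sub_nonneg.2 he.2
  have h := (((strictConcaveOn_negMulLog_one_sub.const_mul hq.1).add_concaveOn
    (concaveOn_negMulLog_affine he' (mul_nonneg hq' he.1))).add_concaveOn
    (concaveOn_negMulLog_affine he.1 (mul_nonneg hq' he'))).add_concaveOn
    (concaveOn_affine (Real.negMulLog ((1 - q) * e) + Real.negMulLog ((1 - q) * (1 - e))
      - (Real.negMulLog (1 - e) + Real.negMulLog e))
      (-(Real.negMulLog ((1 - q) * e) + Real.negMulLog ((1 - q) * (1 - e)))))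
  refine h.congr fun p _ => ?_
  simp only [senseInfo, Pi.add_apply]
  rw [Real.negMulLog_mul (1 - p) (q * e), Real.negMulLog_mul (1 - p) (q * (1 - e))]
  ring

theorem strictConcaveOn_exampleRate (ha : a ∈ Set.Ioo (0 : ℝ) 1) :
    StrictConcaveOn ℝ (Set.Icc 0 1) (exampleRate q e a hq he) := by
  have h := ((Real.strictConcave_binEntropy.const_mul hq.1).inf
    (strictConcaveOn_senseInfo hq he)).const_mul (inv_pos.2 (Real.log_pos one_lt_two))
  refine h.congr fun p hp => ?_
  rw [exampleRate_eq hq he ha hp, div_eq_inv_mul]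
  rfl

theorem continuous_senseInfo (q e : ℝ) : Continuous (senseInfo q e) := by
  have := Real.continuous_negMulLog
  unfold senseInfo
  fun_prop

theorem continuousOn_exampleRate (ha : a ∈ Set.Ioo (0 : ℝ) 1) :
    ContinuousOn (exampleRate q e a hq he) (Set.Icc 0 1) := by
  have h : Continuous fun p => min (q * Real.binEntropy p) (senseInfo q e p) / Real.log 2 :=
    ((continuous_const.mul Real.binEntropy_continuous).min (continuous_senseInfo q e)).div_const _
  exact h.continuousOn.congr fun p hp => exampleRate_eq hq he ha hp

theorem exampleRate_zero (ha : a ∈ Set.Ioo (0 : ℝ) 1) : exampleRate q e a hq he 0 = 0 := by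
  rw [exampleRate_eq hq he ha (Set.left_mem_Icc.2 zero_le_one)]
  have : senseInfo q e 0 = 0 := by
    simp only [senseInfo, zero_mul, sub_zero, one_mul, zero_add]
    ring
  simp [this]

theorem exampleRate_one (ha : a ∈ Set.Ioo (0 : ℝ) 1) : exampleRate q e a hq he 1 = 0 := by
  rw [exampleRate_eq hq he ha (Set.right_mem_Icc.2 zero_le_one)]
  have : senseInfo q e 1 = 0 := by
    simp only [senseInfo, sub_self, zero_mul, one_mul, add_zero, Real.negMulLog_zero]
  simp [this]

theorem exampleIXZ_formula (ha : a ∈ Set.Ioo (0 : ℝ) 1) {p : ℝ} (hp : p ∈ Set.Icc (0 : ℝ) 1) :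
    exampleIXZ q e a hq he p =
      -(∑ i, (![p * e + (1 - q) * (1 - p) * (1 - e), p * (1 - e) + (1 - q) * (1 - p) * e,
            (1 - p) * q * e, (1 - p) * q * (1 - e)] : Fin 4 → ℝ) i *
          Real.logb 2 ((![p * e + (1 - q) * (1 - p) * (1 - e),
            p * (1 - e) + (1 - q) * (1 - p) * e,
            (1 - p) * q * e, (1 - p) * q * (1 - e)] : Fin 4 → ℝ) i))
        - p * H2 e
        + (1 - p) * ∑ i, (![(1 - q) * (1 - e), (1 - q) * e, q * e, q * (1 - e)] :
              Fin 4 → ℝ) i *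
            Real.logb 2 ((![(1 - q) * (1 - e), (1 - q) * e, q * e, q * (1 - e)] :
              Fin 4 → ℝ) i) := by
  have hl : ∀ t : ℝ, t * Real.logb 2 t = -(Real.negMulLog t / Real.log 2) := by
    intro t
    rw [Real.logb, Real.negMulLog]
    ring
  simp only [hl]
  rw [exampleIXZ_eq hq he ha hp, H2_eq_binEntropy_div,
    Real.binEntropy_eq_negMulLog_add_negMulLog_one_sub]
  simp only [Fin.sum_univ_four, senseInfo, Matrix.cons_val]
  -- The stated formula lists the mass of Z = 1 before that of Z = 0, the reverse of `senseInfo`.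
  have h1 : p * e + (1 - q) * (1 - p) * (1 - e) = p * e + (1 - p) * ((1 - q) * (1 - e)) := by ring
  have h2 : p * (1 - e) + (1 - q) * (1 - p) * e = p * (1 - e) + (1 - p) * ((1 - q) * e) := by ring
  rw [h1, h2, mul_assoc (1 - p) q e, mul_assoc (1 - p) q (1 - e)]
  ring

/-- The estimator of the state in the example from the input and the sensing output. -/
noncomputable def exampleEst (q a : ℝ) (x : Fin 2) (z : SenseAlphabet a) : Fin 2 :=
  open Classical in
  if x = 0 then (if 1 - q ≤ q then 1 else 0)
  else if z = senseLetter a 2 ∨ z = senseLetter a 3 then 1 else 0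

theorem letterDist_example_zero :
    (exampleChannel q e a hq he).letterDist (exampleEst q a) 0 = min q (1 - q) := by
  have h : ∀ s, ∑ y, ∑ z, exampleTrans e a 0 s y z = 1 := exampleTrans_sum e a 0
  have : (exampleChannel q e a hq he).letterDist (exampleEst q a) 0
      = ∑ s, bern q s * (if s = (if 1 - q ≤ q then 1 else 0) then 0 else 1) *
        ∑ y, ∑ z, exampleTrans e a 0 s y z := by
    simp only [SDMBC.letterDist, SDMBC.fullLaw, Fintype.sum_prod_type, exampleEst, if_true,
      exampleChannel, Finset.mul_sum]
    refine Finset.sum_congr rfl fun s _ => Finset.sum_congr rfl fun y _ =>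
      Finset.sum_congr rfl fun z _ => ?_
    ring
  rw [this]
  simp only [h, mul_one, Fin.sum_univ_two]
  by_cases hq2 : 1 - q ≤ q
  · simp [hq2, bern]
  · simp [hq2, bern, (not_le.1 hq2).le]

theorem letterDist_example_one (ha : a ∈ Set.Ioo (0 : ℝ) 1) :
    (exampleChannel q e a hq he).letterDist (exampleEst q a) 1 = 0 := by
  obtain ⟨h0, h1⟩ := ha
  have n1 : a ≠ 0 := h0.ne'
  have n2 : a ≠ 1 := h1.ne
  have n4 : (0 : ℝ) ≠ a + 1 := by linarith
  have n5 : (1 : ℝ) ≠ a + 1 := by linarith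
  have hz : ∀ (s y : Fin 2) (z : SenseAlphabet a) (n : Fin 2), (if y = s * 1 ∧ (z : ℝ) = senseValue a 1 s n then (1 : ℝ) else 0) *
      (if s = exampleEst q a 1 z then (0 : ℝ) else 1) = 0 := by
    intro s y z n
    by_cases hc : y = s * 1 ∧ (z : ℝ) = senseValue a 1 s n
    · have : s = exampleEst q a 1 z := by
        have hv := hc.2
        fin_cases s <;> fin_cases n <;>
          simp [senseValue] at hv <;>
          simp [exampleEst, senseLetter, Subtype.ext_iff, hv, n1.symm, n2.symm, n4, n5]
      simp [← this]
    · rw [if_neg hc, zero_mul]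
  simp only [SDMBC.letterDist, SDMBC.fullLaw, exampleChannel, exampleTrans]
  refine Finset.sum_eq_zero fun o _ => ?_
  rw [mul_assoc, Finset.sum_mul, Finset.sum_eq_zero, mul_zero]
  intro n _
  rw [mul_assoc, hz, mul_zero]

/-- The least expected distortion of a state estimate in the example, given the input letter. -/
theorem example_dist_lower (x y : Fin 2) (z : SenseAlphabet a) (s' : Fin 2) :
    (if x = 0 then min q (1 - q) else 0) * ∑ s, (exampleChannel q e a hq he).PS s *
        (exampleChannel q e a hq he).trans x s y z
      ≤ ∑ s, (exampleChannel q e a hq he).PS s * (exampleChannel q e a hq he).trans x s y z *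
          (exampleChannel q e a hq he).dist s s' := by
  by_cases hx : x = 0
  · subst hx
    -- Under input 0 the outputs do not depend on the state, so its posterior is the prior.
    have ht : ∀ s, (exampleChannel q e a hq he).trans 0 s y z
        = (exampleChannel q e a hq he).trans 0 0 y z := by
      intro s
      simp [exampleChannel, exampleTrans, senseValue]
    simp only [ht]
    have h0 := (exampleChannel q e a hq he).trans_nonneg 0 0 y z
    rw [← Finset.sum_mul, (exampleChannel q e a hq he).PS_sum, if_true, one_mul]
    set t := (exampleChannel q e a hq he).trans 0 0 y z
    have h1 := mul_le_mul_of_nonneg_right (min_le_left q (1 - q)) h0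
    have h2 := mul_le_mul_of_nonneg_right (min_le_right q (1 - q)) h0
    fin_cases s' <;> simpa [Fin.sum_univ_two, exampleChannel, bern]
  · rw [if_neg hx, zero_mul]
    exact Finset.sum_nonneg fun s _ => mul_nonneg (mul_nonneg
      ((exampleChannel q e a hq he).PS_nonneg s) ((exampleChannel q e a hq he).trans_nonneg _ _ _ _))
      ((exampleChannel q e a hq he).dist_nonneg _ _)

end Example

/-! ### The capacity-distortion region of the example. -/

section ExampleRegion

variable {q e a : ℝ} (hq : q ∈ Set.Ioo (0 : ℝ) 1) (he : e ∈ Set.Icc (0 : ℝ) 1)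

theorem exampleChannel_dist_le_one (s s' : Fin 2) :
    (exampleChannel q e a hq he).dist s s' ≤ 1 := by
  simp only [exampleChannel]
  split_ifs <;> norm_num

theorem achievable_example (ha : a ∈ Set.Ioo (0 : ℝ) 1) {p : ℝ} (hp : p ∈ Set.Ioo (0 : ℝ) 1)
    {R D : ℝ} (hR : 0 ≤ R) (hRf : R < exampleRate q e a hq he p)
    (hD : p * min q (1 - q) < D) : (exampleChannel q e a hq he).Achievable R 0 D := by
  have hp' := Set.Ioo_subset_Icc_self hp
  have h := mul_lt_mul_of_pos_right hRf (Real.log_pos one_lt_two)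
  rw [exampleRate_mul_log_two hq he ha hp', lt_min_iff] at h
  refine (exampleChannel q e a hq he).achievable_of_lt_infoNats (bern_one_sub_nonneg hp')
    (bern_sum _) (exampleEst q a) (exampleChannel_dist_le_one hq he) hR h.1 h.2 ?_
  rw [Fin.sum_univ_two, letterDist_example_zero, letterDist_example_one hq he ha]
  simpa [bern] using hD

/-- The witness is the fraction of zeros in the codebook. The number of private messages enters
through an equation so that a code with `msgCount 0 n` of them can be substituted. -/
theorem exists_input_law_of_code (ha : a ∈ Set.Ioo (0 : ℝ) 1) {M M1 n : ℕ} (hM1 : M1 = 1)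
    (hM : 0 < M) (hn : 0 < n) (c : DMSCode (Fin 2) (Fin 2) (Fin 2) (SenseAlphabet a) M M1 n) :
    ∃ p ∈ Set.Icc (0 : ℝ) 1,
      Real.log M * (1 - (exampleChannel q e a hq he).errorProb c)
        ≤ n * (exampleRate q e a hq he p * Real.log 2) + 1 ∧
      p * min q (1 - q) ≤ (exampleChannel q e a hq he).distortion c := by
  subst hM1
  set P := codeType fun w => c.enc w 0 with hP
  have h0 : ∀ x, 0 ≤ P x := codeType_nonneg _
  have h1 : P 0 + P 1 = 1 := by
    rw [← Fin.sum_univ_two]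
    exact sum_codeType _ hM hn
  have hp : P 0 ∈ Set.Icc (0 : ℝ) 1 := ⟨h0 0, by linarith [h0 1]⟩
  have hPb : P = bern (1 - P 0) := by
    funext x
    fin_cases x
    · simp [bern]
    · simp [bern]
      linarith
  have hc := (exampleChannel q e a hq he).log_card_mul_le_commLaw hM hn c
  have hs := (exampleChannel q e a hq he).log_card_mul_le_senseLaw hM hn c
  have hd := (exampleChannel q e a hq he).sum_codeType_mul_le_distortion
    (fun x => if x = 0 then min q (1 - q) else 0)
    (fun x => by
      split_ifs
      · exact le_min hq.1.le (sub_nonneg.2 hq.2.le)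
      · exact le_rfl)
    (example_dist_lower hq he) hM hn c
  rw [← hP] at hc hs hd
  refine ⟨P 0, hp, ?_, ?_⟩
  · rw [exampleRate_mul_log_two hq he ha hp, ← hPb]
    rcases min_choice (infoNats P (exampleChannel q e a hq he).commLaw)
      (infoNats P (exampleChannel q e a hq he).senseLaw) with h | h <;> rw [h]
    · exact hc
    · exact hs
  · simpa [Fin.sum_univ_two] using hd

/-- The parameters of the individual codes lie in a compact interval. Along a convergent
subsequence, continuity of the rate function and the vanishing error carry the finite-length bounds
to the limit. -/
theorem exists_input_law_of_achievable (ha : a ∈ Set.Ioo (0 : ℝ) 1) {R D : ℝ}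
    (h : (exampleChannel q e a hq he).Achievable R 0 D) :
    0 ≤ R ∧ ∃ p ∈ Set.Icc (0 : ℝ) 1, R ≤ exampleRate q e a hq he p ∧
      p * min q (1 - q) ≤ D := by
  obtain ⟨hR, -, c, herr, hdist⟩ := h
  refine ⟨hR, ?_⟩
  set ch := exampleChannel q e a hq he with hch
  have hlog2 : 0 < Real.log 2 := Real.log_pos one_lt_two
  -- Lengths are shifted by one because the type of a codebook needs positive block length.
  choose p hp01 hpr hpd using fun n => exists_input_law_of_code hq he ha (msgCount_zero (n + 1))
    (msgCount_pos R (n + 1)) n.succ_pos (c (n + 1))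
  have herr' := herr.comp (tendsto_add_atTop_nat 1)
  obtain ⟨p₀, hp₀, φ, hφ, hlim⟩ := isCompact_Icc.tendsto_subseq hp01
  refine ⟨p₀, hp₀, ?_, ?_⟩
  · have hf : Tendsto (fun k => exampleRate q e a hq he (p (φ k))) atTop
        (𝓝 (exampleRate q e a hq he p₀)) :=
      ((continuousOn_exampleRate hq he ha) p₀ hp₀).tendsto.comp
        (tendsto_nhdsWithin_iff.2 ⟨hlim, Eventually.of_forall fun k => hp01 _⟩)
    have hinv : Tendsto (fun n : ℕ => (1 : ℝ) / ((n : ℝ) + 1)) atTop (𝓝 0) :=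
      tendsto_one_div_add_atTop_nhds_zero_nat
    have hl : Tendsto (fun k => R * Real.log 2 * (1 - ch.errorProb (c (φ k + 1)))) atTop
        (𝓝 (R * Real.log 2)) := by
      have := ((herr'.comp hφ.tendsto_atTop).const_sub 1).const_mul (R * Real.log 2)
      simpa using this
    have hr : Tendsto (fun k => exampleRate q e a hq he (p (φ k)) * Real.log 2
        + 1 / ((φ k : ℝ) + 1)) atTop (𝓝 (exampleRate q e a hq he p₀ * Real.log 2)) := by
      have := (hf.mul_const (Real.log 2)).add (hinv.comp hφ.tendsto_atTop)
      simpa using this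
    refine le_of_mul_le_mul_right (le_of_tendsto_of_tendsto hl hr ?_) hlog2
    have hev : ∀ᶠ k in atTop, ch.errorProb (c (φ k + 1)) < 1 :=
      (herr'.comp hφ.tendsto_atTop).eventually (gt_mem_nhds one_pos)
    filter_upwards [hev] with k hk
    have h1 := hpr (φ k)
    have hn : (0 : ℝ) < (φ k : ℝ) + 1 := by positivity
    have h2 : ((φ k + 1 : ℕ) : ℝ) * (R * Real.log 2) ≤ Real.log (msgCount R (φ k + 1)) := by
      rw [Real.le_log_iff_exp_le (by exact_mod_cast msgCount_pos R _)]
      exact exp_le_msgCount R _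
    have h3 := (mul_le_mul_of_nonneg_right h2 (sub_nonneg.2 hk.le)).trans h1
    push_cast at h3
    refine le_of_mul_le_mul_left ?_ hn
    calc ((φ k : ℝ) + 1) * (R * Real.log 2 * (1 - ch.errorProb (c (φ k + 1))))
        = ((φ k : ℝ) + 1) * (R * Real.log 2) * (1 - ch.errorProb (c (φ k + 1))) := by ring
      _ ≤ _ := h3
      _ = _ := by field_simp
  · refine le_of_forall_pos_lt_add fun ε hε => ?_
    have hle : ∀ n, ch.distortion (c n) ≤ 1 := by
      intro n
      have hdle : ∀ {M1 : ℕ} (_ : M1 = 1)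
          (c' : DMSCode (Fin 2) (Fin 2) (Fin 2) (SenseAlphabet a) (msgCount R n) M1 n),
          ch.distortion c' ≤ 1 := by
        rintro M1 rfl c'
        exact ch.distortion_le_one (exampleChannel_dist_le_one hq he) c'
      exact hdle (msgCount_zero n) (c n)
    have hev : ∀ᶠ n in atTop, ch.distortion (c n) < D + ε / 2 :=
      eventually_lt_of_limsup_lt (by linarith)
        (isBoundedUnder_of ⟨1, hle⟩)
    have hev' := (tendsto_add_atTop_nat 1).eventually hev
    have := le_of_tendsto (hlim.mul_const (min q (1 - q)))
      ((hφ.tendsto_atTop.eventually hev').mono fun k hk => (hpd (φ k)).trans hk.le)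
    linarith

theorem fullDecodingRegion_example (ha : a ∈ Set.Ioo (0 : ℝ) 1) {pmax : ℝ}
    (hp : pmax ∈ Set.Icc (0 : ℝ) 1)
    (hmax : IsMaxOn (exampleRate q e a hq he) (Set.Icc (0 : ℝ) 1) pmax) :
    (exampleChannel q e a hq he).fullDecodingRegion
      = regionBelow (exampleRate q e a hq he) (min q (1 - q)) pmax :=
  closure_eq_regionBelow (continuousOn_exampleRate hq he ha)
    (strictConcaveOn_exampleRate hq he ha) (exampleRate_zero hq he ha)
    (exampleRate_one hq he ha) (lt_min hq.1 (sub_pos.2 hq.2))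
    (fun _ ht => exists_input_law_of_achievable hq he ha ht)
    (fun _ hp _ _ hR hRf hD => achievable_example hq he ha hp hR hRf hD) hp hmax

end ExampleRegion

theorem corollary5 (q e a : ℝ) (hq : q ∈ Set.Ioo (0 : ℝ) 1) (he : e ∈ Set.Icc (0 : ℝ) 1)
    (ha : a ∈ Set.Ioo (0 : ℝ) 1) :
    (∀ p ∈ Set.Icc (0 : ℝ) 1,
      exampleIXZ q e a hq he p =
        -(∑ i, (![p * e + (1 - q) * (1 - p) * (1 - e), p * (1 - e) + (1 - q) * (1 - p) * e,
              (1 - p) * q * e, (1 - p) * q * (1 - e)] : Fin 4 → ℝ) i *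
            Real.logb 2 ((![p * e + (1 - q) * (1 - p) * (1 - e),
              p * (1 - e) + (1 - q) * (1 - p) * e,
              (1 - p) * q * e, (1 - p) * q * (1 - e)] : Fin 4 → ℝ) i))
          - p * H2 e
          + (1 - p) * ∑ i, (![(1 - q) * (1 - e), (1 - q) * e, q * e, q * (1 - e)] :
                Fin 4 → ℝ) i *
              Real.logb 2 ((![(1 - q) * (1 - e), (1 - q) * e, q * e, q * (1 - e)] :
                Fin 4 → ℝ) i)) ∧
    (∃! pmax, pmax ∈ Set.Icc (0 : ℝ) 1 ∧
      IsMaxOn (exampleRate q e a hq he) (Set.Icc (0 : ℝ) 1) pmax) ∧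
    ∀ pmax ∈ Set.Icc (0 : ℝ) 1, IsMaxOn (exampleRate q e a hq he) (Set.Icc (0 : ℝ) 1) pmax →
      (exampleChannel q e a hq he).fullDecodingRegion =
          {t : ℝ × ℝ | ∃ p ∈ Set.Icc (0 : ℝ) pmax,
            0 ≤ t.1 ∧ t.1 ≤ exampleRate q e a hq he p ∧ p * min q (1 - q) ≤ t.2} ∧
      (∀ p ∈ Set.Icc (0 : ℝ) pmax,
        IsGreatest {R | (R, p * min q (1 - q)) ∈ (exampleChannel q e a hq he).fullDecodingRegion}
          (exampleRate q e a hq he p)) ∧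
      (fun D => ((exampleChannel q e a hq he).fullDecodingCapacity D, D)) ''
            Set.Icc (0 : ℝ) (pmax * min q (1 - q)) =
          (fun p => (exampleRate q e a hq he p, p * min q (1 - q))) '' Set.Icc (0 : ℝ) pmax ∧
      (∀ D, pmax * min q (1 - q) ≤ D →
        (exampleChannel q e a hq he).fullDecodingCapacity D = exampleRate q e a hq he pmax) := by
  have hsc := strictConcaveOn_exampleRate hq he ha
  refine ⟨fun p hp => exampleIXZ_formula hq he ha hp,
    hsc.existsUnique_isMaxOn_Icc (continuousOn_exampleRate hq he ha), fun pmax hp hmax => ?_⟩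
  have hm : 0 < min q (1 - q) := lt_min hq.1 (sub_pos.2 hq.2)
  have hreg := fullDecodingRegion_example hq he ha hp hmax
  have h0 := exampleRate_zero hq he ha
  have hgr : ∀ p ∈ Set.Icc (0 : ℝ) pmax,
      IsGreatest {R | (R, p * min q (1 - q)) ∈ (exampleChannel q e a hq he).fullDecodingRegion}
        (exampleRate q e a hq he p) := by
    intro p hpm
    rw [hreg]
    exact isGreatest_regionBelow hsc.concaveOn h0 hm hp hmax hpm
  refine ⟨hreg, hgr, ?_, fun D hD => ?_⟩
  · have hcap : ∀ p ∈ Set.Icc (0 : ℝ) pmax,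
        (exampleChannel q e a hq he).fullDecodingCapacity (p * min q (1 - q))
          = exampleRate q e a hq he p := fun p hpm => (hgr p hpm).csSup_eq
    ext t
    constructor
    · rintro ⟨D, hD, rfl⟩
      -- The map from p to p min(q, 1 - q) is a bijection of [0, pmax] onto the range of
      -- distortions, so the curve is parametrized equally well by p.
      have hDm : D / min q (1 - q) * min q (1 - q) = D := div_mul_cancel₀ _ hm.ne'
      have hpm : D / min q (1 - q) ∈ Set.Icc (0 : ℝ) pmax :=
        ⟨div_nonneg hD.1 hm.le, (div_le_iff₀ hm).2 hD.2⟩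
      refine ⟨D / min q (1 - q), hpm, ?_⟩
      dsimp only
      rw [← hcap _ hpm, hDm]
    · rintro ⟨p, hpm, rfl⟩
      refine ⟨p * min q (1 - q),
        ⟨mul_nonneg hpm.1 hm.le, mul_le_mul_of_nonneg_right hpm.2 hm.le⟩, ?_⟩
      dsimp only
      rw [hcap p hpm]
  · have hg := isGreatest_regionBelow_of_le hsc.concaveOn h0 hp hmax hD
    rw [← hreg] at hg
    exact hg.csSup_eq
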